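/- Let $X=\{X(t)\}_{t\ge 0}$ be a real-valued Lévy process with characteristic triplet $(a,b^2,\nu)$, i.e. $X$ has càdlàg paths, $X(0)=0$ a.s., stationary independent increments, and $\mathbf E e^{iuX(t)}=\exp\big(t\,[\,iau-\tfrac12 b^2u^2+\int(e^{iux}-1-iux1_{\{|x|\le 1\}})\,\nu(dx)]\big)$. Suppose that $x\mapsto\nu[x,\infty)$ is regularly varying at infinity with index $-\alpha$, where $\alpha>1$. Let $$\bar X_n(s)=\tfrac1n X(ns)-s\Big(a+\int_{|x|>1}x\,\nu(dx)\Big),\qquad s\in[0,1],$$ (that is, $\bar X_n(s)=X(ns)/n-s\,\mathbf E X(1)$), regarded as a random element of the space $\mathbb D$ of real-valued càdlàg functions on $[0,1]$ with the Skorokhod $J_1$ topology. For $\xi\in\mathbb D$ let $\mathcal D_+(\xi)$ and $\mathcal D_-(\xi)$ be the numbers of upward and downward jumps of $\xi$. For a function $J:\mathbb D\to[0,\infty]$, say that $\bar X_n$ satisfies the full large deviation principle (LDP) with speed $\log n$ and rate $J$ if $$-\inf_{G}J\le\liminf_{n\to\infty}\frac{\log\mathbf P(\bar X_n\in G)}{\log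 n}\ \text{ for every open } G,\qquad \limsup_{n\to\infty}\frac{\log\mathbf P(\bar X_n\in F)}{\log n}\le-\inf_{F}J\ \text{ for every closed } F$$ (with $\inf_\emptyset J=\infty$ and $\log 0=-\infty$). (i) (Two-sided case.) Suppose that $x\mapsto\nu(-\infty,-x]$ is regularly varying at infinity with index $-\beta$, where $\beta>1$. Then there is no function $J:\mathbb D\to[0,\infty]$ (lower semicontinuous or not) with which $\bar X_n$ satisfies the full LDP with speed $\log n$. Moreover, let $I(\xi)=(\alpha-1)\mathcal D_+(\xi)+(\beta-1)\mathcal D_-(\xi)$ if $\xi$ is a step function with $\xi(0)=0$, and $I(\xi)=\infty$ otherwise. Then the large deviation upper bound with $I$ fails for some closed set, and such a set can be found among the closed sets that depend only on the largest jumps: with $$\pi(\xi)=\Big(\sup_{t\in(0,1]}(\xi(t)-\xi(t-)),\ \sup_{t\in(0,1]}(\xi(t-)-\xi(t))\Big),$$ there is a closed set $A\subseteq\mathbb R^2$ such that $\pi^{-1}(A)$ is closed in $\mathbb D$ and $$\limsup_{n\to\infty}\frac{\log\mathbf P(\pi(\bar X_n)\in A)}{\log n}>-\inf_{\xi\in\pi^{-1}(A)}I(\xi).$$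 (ii) (Spectrally positive case.) Suppose instead that $\nu(-\infty,0)=0$. Then again there is no function $J:\mathbb D\to[0,\infty]$ with which $\bar X_n$ satisfies the full LDP with speed $\log n$. Moreover, with $I(\xi)=(\alpha-1)\mathcal D_+(\xi)$ if $\xi$ is a nondecreasing step function with $\xi(0)=0$, and $I(\xi)=\infty$ otherwise, there is a closed set $F\subseteq\mathbb D$ such that $$\limsup_{n\to\infty}\frac{\log\mathbf P(\bar X_n\in F)}{\log n}>-\inf_{\xi\in F}I(\xi).$$ -/

import Mathlib

open Set Filter Topology MeasureTheory ProbabilityTheory unitInterval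
open scoped NNReal ENNReal

noncomputable section

/-! ### The Skorokhod space `𝔻([0,1], ℝ)` with the `J₁` metric -/

/-- Right-continuous functions with left limits. -/
def IsCadlag {T : Type*} [TopologicalSpace T] [Preorder T] (f : T → ℝ) : Prop :=
  ∀ t, ContinuousWithinAt f (Ici t) t ∧ ∃ l, Tendsto f (𝓝[<] t) (𝓝 l)

/-- The space of real-valued càdlàg functions on `[0,1]`. -/
structure SkorokhodSpace where
  toFun : I → ℝ
  isCadlag : IsCadlag toFun

namespace SkorokhodSpace

instance : CoeFun SkorokhodSpace (fun _ => I → ℝ) := ⟨SkorokhodSpace.toFun⟩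

/-- `‖λ - e‖ ∨ ‖x ∘ λ - y‖`, where `‖·‖` is the supremum norm and `e` is the identity. -/
def distortion (x y : I → ℝ) (l : I ≃o I) : ℝ≥0∞ :=
  max (⨆ t, edist (l t) t) (⨆ t, edist (x (l t)) (y t))

theorem distortion_symm_le (x y : I → ℝ) (l : I ≃o I) :
    distortion y x l.symm ≤ distortion x y l := by
  refine max_le (le_max_of_le_left (iSup_le fun t => ?_)) (le_max_of_le_right (iSup_le fun t => ?_))
  · have := le_iSup (fun s => edist (l s) s) (l.symm t)
    simpa [edist_comm] using this
  · have := le_iSup (fun s => edist (x (l s)) (y s)) (l.symm t)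
    simpa [edist_comm] using this

theorem distortion_trans_le (x y z : I → ℝ) (l m : I ≃o I) :
    distortion x z (m.trans l) ≤ distortion x y l + distortion y z m := by
  refine max_le (iSup_le fun t => ?_) (iSup_le fun t => ?_)
  · refine (edist_triangle (l (m t)) (m t) t).trans (add_le_add ?_ ?_)
    · exact le_max_of_le_left (le_iSup (fun s => edist (l s) s) (m t))
    · exact le_max_of_le_left (le_iSup (fun s => edist (m s) s) t)
  · refine (edist_triangle (x (l (m t))) (y (m t)) (z t)).trans (add_le_add ?_ ?_)
    · exact le_max_of_le_right (le_iSup (fun s => edist (x (l s)) (y s)) (m t))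
    · exact le_max_of_le_right (le_iSup (fun s => edist (y (m s)) (z s)) t)

/-- The `J₁` distance: infimum of the distortion over all increasing homeomorphisms of `[0,1]`
onto itself (these are exactly the order isomorphisms). It defines the topology of the space. -/
instance : PseudoEMetricSpace SkorokhodSpace where
  edist x y := ⨅ l : I ≃o I, distortion x y l
  edist_self x := by
    refine le_antisymm (iInf_le_of_le (OrderIso.refl I) ?_) bot_le
    simp [distortion]
  edist_comm x y := by
    refine le_antisymm ?_ ?_
    · exact le_iInf fun l => iInf_le_of_le l.symm (distortion_symm_le y x l)
    · exact le_iInf fun l => iInf_le_of_le l.symm (distortion_symm_le x y l)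
  edist_triangle x y z := by
    rw [ENNReal.iInf_add]
    refine le_iInf fun l => ?_
    rw [ENNReal.add_iInf]
    exact le_iInf fun m => iInf_le_of_le (m.trans l) (distortion_trans_le x y z l m)

/-- The jump `ξ(t) - ξ(t-)`. -/
def jump (ξ : SkorokhodSpace) (t : I) : ℝ := ξ t - Function.leftLim ξ t

/-- The largest-jump map: largest upward jump and largest downward jump over `t ∈ (0,1]`. -/
def largestJumps (ξ : SkorokhodSpace) : ℝ × ℝ :=
  (⨆ t : Ioc (0 : I) 1, ξ.jump t, ⨆ t : Ioc (0 : I) 1, -ξ.jump t)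

/-- The number of upward jumps. -/
def numUp (ξ : SkorokhodSpace) : ℕ∞ := {t : I | 0 < t ∧ 0 < ξ.jump t}.encard

/-- The number of downward jumps. -/
def numDown (ξ : SkorokhodSpace) : ℕ∞ := {t : I | 0 < t ∧ ξ.jump t < 0}.encard

/-- Step functions: for some finite set `S` of times, the path takes equal values at `s ≤ t`
whenever there is no point of `S` in `(s, t]`. -/
def IsStep (ξ : SkorokhodSpace) : Prop :=
  ∃ S : Finset I, ∀ s t : I, s ≤ t → (∀ u ∈ S, ¬(s < u ∧ u ≤ t)) → ξ s = ξ t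

open Classical in
/-- The two-sided rate function: `(α-1) 𝒟₊(ξ) + (β-1) 𝒟₋(ξ)` for step functions vanishing
at `0`, and `∞` otherwise. -/
def rate (α β : ℝ) (ξ : SkorokhodSpace) : ℝ≥0∞ :=
  if ξ.IsStep ∧ ξ 0 = 0 then
    ENNReal.ofReal (α - 1) * (ξ.numUp : ℝ≥0∞) + ENNReal.ofReal (β - 1) * (ξ.numDown : ℝ≥0∞)
  else ∞

open Classical in
/-- The one-sided rate function: `(α-1) 𝒟₊(ξ)` for nondecreasing step functions vanishing
at `0`, and `∞` otherwise. -/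
def rateOneSided (α : ℝ) (ξ : SkorokhodSpace) : ℝ≥0∞ :=
  if ξ.IsStep ∧ Monotone ξ.toFun ∧ ξ 0 = 0 then
    ENNReal.ofReal (α - 1) * (ξ.numUp : ℝ≥0∞)
  else ∞

end SkorokhodSpace

/-! ### Lévy processes -/

/-- Real-valued Lévy processes with time set `[0,∞)`. -/
structure IsLevyProcess {Ω : Type*} [MeasurableSpace Ω] (X : ℝ≥0 → Ω → ℝ) (P : Measure Ω) :
    Prop where
  measurable : ∀ t, Measurable (X t)
  zero : ∀ᵐ ω ∂P, X 0 ω = 0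
  indep : HasIndepIncrements X P
  stationary : ∀ s t : ℝ≥0, IdentDistrib (fun ω => X (s + t) ω - X s ω) (X t) P P
  cadlag : ∀ ω, IsCadlag (fun t => X t ω)

/-- Lévy measures on `ℝ`. -/
def IsLevyMeasure (ν : Measure ℝ) : Prop :=
  ν {0} = 0 ∧ ∫⁻ x, ENNReal.ofReal (min 1 (x ^ 2)) ∂ν < ∞

/-- The Lévy–Khintchine exponent with drift `a`, Gaussian variance `b²`, Lévy measure `ν`
and truncation `|x| ≤ 1`. -/
def levyExponent (a b : ℝ) (ν : Measure ℝ) (u : ℝ) : ℂ :=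
  Complex.I * a * u - (b : ℂ) ^ 2 * (u : ℂ) ^ 2 / 2
    + ∫ x : ℝ, (Complex.exp (Complex.I * u * x) - 1
        - (if |x| ≤ 1 then Complex.I * u * x else 0)) ∂ν

/-- `X` has characteristics `(a, b², ν)`; in particular `ν` is its Lévy measure. -/
def HasLevyTriplet {Ω : Type*} [MeasurableSpace Ω] (X : ℝ≥0 → Ω → ℝ) (P : Measure Ω)
    (a b : ℝ) (ν : Measure ℝ) : Prop :=
  IsLevyMeasure ν ∧
    ∀ (t : ℝ≥0) (u : ℝ), charFun (P.map (X t)) u = Complex.exp ((t : ℂ) * levyExponent a b ν u)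

/-- Regular variation at infinity with index `ρ`. -/
def IsRegularlyVarying (f : ℝ → ℝ) (ρ : ℝ) : Prop :=
  (∀ᶠ x in atTop, 0 < f x) ∧
    ∀ c : ℝ, 0 < c → Tendsto (fun x => f (c * x) / f x) atTop (𝓝 (c ^ ρ))

theorem IsCadlag.comp_mul {x : ℝ≥0 → ℝ} (hx : IsCadlag x) (n : ℕ) :
    IsCadlag (fun s : I => x (n * toNNReal s)) := by
  have hc : Continuous (fun s : I => (n : ℝ≥0) * toNNReal s) := by fun_prop
  intro t
  refine ⟨?_, ?_⟩
  · refine ContinuousWithinAt.comp (f := fun s : I => (n : ℝ≥0) * toNNReal s)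
      (hx (n * toNNReal t)).1 hc.continuousWithinAt ?_
    intro s hs
    exact mul_le_mul_right (show toNNReal t ≤ toNNReal s from hs) _
  · rcases Nat.eq_zero_or_pos n with rfl | hn
    · exact ⟨x 0, by simpa using tendsto_const_nhds⟩
    · obtain ⟨l, hl⟩ := (hx (n * toNNReal t)).2
      refine ⟨l, hl.comp (tendsto_nhdsWithin_iff.2 ⟨hc.continuousWithinAt, ?_⟩)⟩
      filter_upwards [self_mem_nhdsWithin] with s hs
      exact mul_lt_mul_of_pos_left (show toNNReal s < toNNReal t from hs) (by exact_mod_cast hn)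

theorem IsCadlag.affine {x : I → ℝ} (hx : IsCadlag x) (b c : ℝ) :
    IsCadlag (fun s : I => x s / b - (s : ℝ) * c) := by
  have hc : Continuous (fun s : I => (s : ℝ) * c) := by fun_prop
  intro t
  obtain ⟨l, hl⟩ := (hx t).2
  exact ⟨((hx t).1.div_const b).sub hc.continuousWithinAt,
    ⟨_, (hl.div_const b).sub (hc.continuousWithinAt (s := Iio t) (x := t))⟩⟩

/-- The mean `a + ∫_{|x|>1} x ν(dx)` of the process at time `1`. -/
def levyMean (a : ℝ) (ν : Measure ℝ) : ℝ := a + ∫ x in {x : ℝ | 1 < |x|}, x ∂ν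

/-- The centered and scaled process `X̄ₙ(s) = X(ns)/n - s (a + ∫_{|x|>1} x ν(dx))`, `s ∈ [0,1]`,
as a random element of the Skorokhod space. -/
def scaledProcess {Ω : Type*} [MeasurableSpace Ω] {X : ℝ≥0 → Ω → ℝ} {P : Measure Ω}
    (hX : IsLevyProcess X P) (a : ℝ) (ν : Measure ℝ) (n : ℕ) (ω : Ω) : SkorokhodSpace where
  toFun s := X (n * toNNReal s) ω / n - s * levyMean a ν
  isCadlag := ((hX.cadlag ω).comp_mul n).affine n (levyMean a ν)

/-! ### Large deviation principles with speed `log n` -/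

/-- `log P(Yₙ ∈ A) / log n`, with `log 0 = -∞`. -/
def logRate {Ω S : Type*} [MeasurableSpace Ω] (P : Measure Ω) (Y : ℕ → Ω → S) (A : Set S)
    (n : ℕ) : EReal :=
  ENNReal.log (P {ω | Y n ω ∈ A}) / ((Real.log n : ℝ) : EReal)

/-- The infimum of `J` over `A`, equal to `∞` if `A` is empty. -/
def rateInf {S : Type*} (J : S → ℝ≥0∞) (A : Set S) : EReal := ⨅ x ∈ A, ((J x : ℝ≥0∞) : EReal)

/-- The large deviation lower bound for open sets. -/
def LDPLowerBound {Ω S : Type*} [MeasurableSpace Ω] [TopologicalSpace S] (P : Measure Ω)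
    (Y : ℕ → Ω → S) (J : S → ℝ≥0∞) : Prop :=
  ∀ G : Set S, IsOpen G → -rateInf J G ≤ liminf (logRate P Y G) atTop

/-- The large deviation upper bound for all closed sets. -/
def LDPUpperBound {Ω S : Type*} [MeasurableSpace Ω] [TopologicalSpace S] (P : Measure Ω)
    (Y : ℕ → Ω → S) (J : S → ℝ≥0∞) : Prop :=
  ∀ F : Set S, IsClosed F → limsup (logRate P Y F) atTop ≤ -rateInf J F

/-- The full (strong) large deviation principle with speed `log n`. Lower semicontinuity of `J`
is not demanded. -/
def FullLDP {Ω S : Type*} [MeasurableSpace Ω] [TopologicalSpace S] (P : Measure Ω)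
    (Y : ℕ → Ω → S) (J : S → ℝ≥0∞) : Prop :=
  LDPLowerBound P Y J ∧ LDPUpperBound P Y J

end

/-!
The failure of the large deviation principle rests on one observation. At speed `log n` an upward
jump of size `n ^ γ` of the unscaled process, with `γ > 1` close to `1`, costs barely more than a
jump of size `n`: both have probability of order `n ^ (-(α - 1))` up to a small change of the
exponent. A jump of bounded size, of the kind carried by the second tail, costs nothing. Hence the
scaled process has an upward jump `L` growing like a power of `n`, together with a second jump of
size at least `exp (-L)`, with probability of order `n ^ (-(α - 1))`
(`eventually_le_measure_hasTwoJumps`). All such paths lie in a closed set, namely the set where the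
pair of largest jumps belongs to `jumpRegion`; in the one-sided case the second coordinate is the
second largest upward jump. Every path of this closed set has two jumps bounded away from `0`,
and so do all paths in a neighbourhood of it. That neighbourhood has probability of order at most
`n ^ (-(α - 1) - (β - 1))` (`eventually_measure_hasTwoJumps_le`), with `β = α` in the one-sided
case. A lower bound for open sets thus forces any rate function to be at least
`(α - 1) + (β - 1)` on the closed set, up to an arbitrarily small loss, against the upper bound
(`not_exists_fullLDP`); the given rate functions have this lower bound by their definition.

Only jumps matter, so no Lévy–Itô decomposition is used. The two probability estimates
(`measure_exists_two_jumps_le`, `le_measure_exists_two_jumps`) come from increments over a grid of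
mesh `1 / m`, which are independent and identically distributed. As `m → ∞`, increments that stay
away from `0` correspond to jumps, by the càdlàg property and compactness
(`IsCadlag.eventually_gridIncrement_mem`, `IsCadlag.exists_pathJump_mem`), and `m` times the law at
time `1 / m` converges to the Lévy measure away from `0`
(`tendsto_mul_integral_levyMeasure`). The latter follows from Lévy's continuity theorem once the
laws are multiplied by the weight `1 - exp (-x² / 2)`, which turns a characteristic function `φ`
into `φ u - E φ (u + Z)` with `Z` standard Gaussian.
-/

noncomputable section

/-! ### The Lévy–Khintchine exponent under a Gaussian shift -/

/-- The weight `1 - exp (-x² / 2)`: it makes a Lévy measure finite, and multiplication by it acts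
on characteristic functions as subtraction of the average over a standard Gaussian shift. -/
def gaussWeight (x : ℝ) : ℝ := 1 - Real.exp (-x ^ 2 / 2)

theorem continuous_gaussWeight : Continuous gaussWeight := by
  unfold gaussWeight; fun_prop

theorem gaussWeight_nonneg (x : ℝ) : 0 ≤ gaussWeight x := by
  have : Real.exp (-x ^ 2 / 2) ≤ 1 := Real.exp_le_one_iff.2 (by nlinarith [sq_nonneg x])
  unfold gaussWeight; linarith

theorem gaussWeight_le_min (x : ℝ) : gaussWeight x ≤ min 1 (x ^ 2) := by
  refine le_min ?_ ?_
  · have := Real.exp_pos (-x ^ 2 / 2)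
    unfold gaussWeight; linarith
  · have := Real.add_one_le_exp (-x ^ 2 / 2)
    unfold gaussWeight; nlinarith [sq_nonneg x]

theorem gaussWeight_pos {x : ℝ} (hx : x ≠ 0) : 0 < gaussWeight x := by
  have : Real.exp (-x ^ 2 / 2) < 1 := by
    rw [Real.exp_lt_one_iff]
    have := sq_pos_of_ne_zero hx
    linarith
  unfold gaussWeight; linarith

theorem gaussWeight_mono {r x : ℝ} (hr : 0 ≤ r) (h : r ≤ |x|) : gaussWeight r ≤ gaussWeight x := by
  have : r ^ 2 ≤ x ^ 2 := by rw [← sq_abs x]; gcongr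
  unfold gaussWeight
  gcongr

/-- The integrand of the Lévy–Khintchine formula. -/
def levyKernel (u x : ℝ) : ℂ :=
  Complex.exp (Complex.I * u * x) - 1 - (if |x| ≤ 1 then Complex.I * u * x else 0)

theorem norm_exp_I_mul_mul (u x : ℝ) : ‖Complex.exp (Complex.I * u * x)‖ = 1 := by
  rw [show Complex.I * u * x = ((u * x : ℝ) : ℂ) * Complex.I by push_cast; ring]
  exact Complex.norm_exp_ofReal_mul_I _

theorem norm_levyKernel_le (u x : ℝ) : ‖levyKernel u x‖ ≤ 3 * (1 + u ^ 2) * min 1 (x ^ 2) := by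
  have he := norm_exp_I_mul_mul u x
  have h2 : ‖Complex.exp (Complex.I * u * x) - 1‖ ≤ 2 :=
    (norm_sub_le _ _).trans (by rw [he, norm_one]; norm_num)
  unfold levyKernel
  split_ifs with hx
  · have hn : ‖Complex.I * u * x‖ = |u| * |x| := by simp
    have hx2 : x ^ 2 ≤ 1 := by rw [← sq_abs]; exact pow_le_one₀ (abs_nonneg x) hx
    rw [min_eq_right hx2]
    have key : ‖Complex.exp (Complex.I * u * x) - 1 - Complex.I * u * x‖ ≤ 3 * (|u| * |x|) ^ 2 := by
      by_cases h : ‖Complex.I * u * x‖ ≤ 1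
      · have := Complex.norm_exp_sub_one_sub_id_le h
        rw [hn] at this
        nlinarith [sq_nonneg (|u| * |x|)]
      · refine (norm_sub_le _ _).trans ?_
        rw [hn] at h ⊢
        nlinarith
    refine key.trans ?_
    rw [mul_pow, sq_abs, sq_abs]
    nlinarith [sq_nonneg x]
  · rw [sub_zero]
    have : 1 ≤ x ^ 2 := by rw [← sq_abs]; exact one_le_pow₀ (not_le.1 hx).le
    rw [min_eq_left this]
    nlinarith [sq_nonneg u]

theorem measurable_levyKernel : Measurable (Function.uncurry levyKernel) := by
  unfold levyKernel Function.uncurry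
  refine Measurable.sub (by fun_prop) (Measurable.ite ?_ (by fun_prop) (by fun_prop))
  exact measurableSet_le (by fun_prop) (by fun_prop)

section Levy

variable {a b : ℝ} {ν : Measure ℝ}

theorem IsLevyMeasure.integrable_min (hν : IsLevyMeasure ν) :
    Integrable (fun x : ℝ => min 1 (x ^ 2)) ν := by
  refine ⟨by fun_prop, ?_⟩
  rw [hasFiniteIntegral_iff_ofReal (.of_forall fun x => le_min zero_le_one (sq_nonneg x))]
  exact hν.2

/-- A Lévy measure has a density with respect to a finite measure. -/
theorem IsLevyMeasure.sFinite (hν : IsLevyMeasure ν) : SFinite ν := by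
  set f : ℝ → ℝ≥0∞ := fun x => ENNReal.ofReal (min 1 (x ^ 2)) with hf
  have hfm : Measurable f := by fun_prop
  have h0 : ∀ᵐ x ∂ν, f x ≠ 0 := by
    have : ∀ᵐ x ∂ν, x ∉ ({0} : Set ℝ) := measure_eq_zero_iff_ae_notMem.1 hν.1
    filter_upwards [this] with x hx
    simpa [hf] using hx
  have : IsFiniteMeasure (ν.withDensity f) := isFiniteMeasure_withDensity hν.2.ne
  rw [← withDensity_inv_same hfm h0 (.of_forall fun x => ENNReal.ofReal_ne_top)]
  infer_instance

theorem IsLevyMeasure.integrable_levyKernel (hν : IsLevyMeasure ν) (u : ℝ) :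
    Integrable (levyKernel u) ν :=
  (hν.integrable_min.const_mul (3 * (1 + u ^ 2))).mono'
    (measurable_levyKernel.comp measurable_prodMk_left).aestronglyMeasurable
    (.of_forall fun x => norm_levyKernel_le u x)

theorem IsLevyMeasure.norm_levyExponent_le (hν : IsLevyMeasure ν) (a b : ℝ) :
    ∃ C, ∀ u, ‖levyExponent a b ν u‖ ≤ C * (1 + u ^ 2) := by
  refine ⟨|a| + b ^ 2 + 3 * ∫ x, min 1 (x ^ 2) ∂ν, fun u => ?_⟩
  have h1 : ‖∫ x, levyKernel u x ∂ν‖ ≤ 3 * (1 + u ^ 2) * ∫ x, min 1 (x ^ 2) ∂ν := by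
    rw [← integral_const_mul]
    exact norm_integral_le_of_norm_le (hν.integrable_min.const_mul _)
      (.of_forall fun x => norm_levyKernel_le u x)
  have h2 : ‖Complex.I * a * u‖ ≤ |a| * (1 + u ^ 2) := by
    simp only [norm_mul, Complex.norm_I, one_mul, Complex.norm_real, Real.norm_eq_abs]
    gcongr
    nlinarith [sq_abs u, sq_nonneg (|u| - 1)]
  have h3 : ‖(b : ℂ) ^ 2 * (u : ℂ) ^ 2 / 2‖ ≤ b ^ 2 * (1 + u ^ 2) := by
    simp only [norm_mul, norm_div, norm_pow, Complex.norm_real, Real.norm_eq_abs, sq_abs]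
    norm_num
    nlinarith [sq_nonneg b, sq_nonneg u, mul_nonneg (sq_nonneg b) (sq_nonneg u)]
  calc ‖levyExponent a b ν u‖ ≤ ‖Complex.I * a * u‖ + ‖(b : ℂ) ^ 2 * (u : ℂ) ^ 2 / 2‖
        + ‖∫ x, levyKernel u x ∂ν‖ :=
        (norm_add_le _ _).trans (add_le_add_left (norm_sub_le _ _) _)
    _ ≤ _ := by linarith

theorem integrable_one_add_sq_gaussian (u : ℝ) :
    Integrable (fun z : ℝ => 1 + (u + z) ^ 2) (gaussianReal 0 1) := by
  have h1 : Integrable (fun z : ℝ => z) (gaussianReal 0 1) :=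
    (memLp_id_gaussianReal (μ := 0) (v := 1) 1).integrable (by simp)
  have h2 : Integrable (fun z : ℝ => z ^ 2) (gaussianReal 0 1) :=
    (memLp_id_gaussianReal (μ := 0) (v := 1) 2).integrable_sq
  have : (fun z : ℝ => 1 + (u + z) ^ 2) = fun z => (1 + u ^ 2) + (2 * u * z + z ^ 2) := by
    ext z; ring
  rw [this]
  exact (integrable_const _).add ((h1.const_mul _).add h2)

theorem integral_exp_gaussian (u x : ℝ) :
    ∫ z : ℝ, Complex.exp (Complex.I * (u + z : ℝ) * x) ∂(gaussianReal 0 1) =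
      Complex.exp (Complex.I * u * x) * (Real.exp (-x ^ 2 / 2) : ℝ) := by
  have h := charFun_gaussianReal (μ := 0) (v := 1) x
  rw [charFun_apply_real] at h
  calc _ = ∫ z : ℝ, Complex.exp (Complex.I * u * x) * Complex.exp (x * z * Complex.I)
        ∂(gaussianReal 0 1) := by
        congr 1; ext z; rw [← Complex.exp_add]; congr 1; push_cast; ring
    _ = _ := by
        rw [integral_const_mul, h]; congr 1; push_cast; congr 1; simp; ring

theorem integrable_ofReal_gaussian : Integrable (fun z : ℝ => (z : ℂ)) (gaussianReal 0 1) :=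
  ((memLp_id_gaussianReal (μ := 0) (v := 1) 1).integrable (by simp)).ofReal

theorem integral_ofReal_gaussian : ∫ z : ℝ, (z : ℂ) ∂(gaussianReal 0 1) = 0 := by
  rw [integral_complex_ofReal, integral_id_gaussianReal]; simp

theorem integral_levyKernel_gaussian (u x : ℝ) :
    ∫ z : ℝ, levyKernel (u + z) x ∂(gaussianReal 0 1) =
      levyKernel u x - Complex.exp (Complex.I * u * x) * (gaussWeight x : ℝ) := by
  have h1 : Integrable (fun z : ℝ => Complex.exp (Complex.I * (u + z : ℝ) * x))
      (gaussianReal 0 1) :=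
    (integrable_const (1 : ℝ)).mono' (by fun_prop)
      (.of_forall fun z => (norm_exp_I_mul_mul (u + z) x).le)
  have hz := integrable_ofReal_gaussian
  have hz0 := integral_ofReal_gaussian
  have h2 : Integrable (fun z : ℝ => Complex.I * (u + z : ℝ) * x) (gaussianReal 0 1) := by
    push_cast
    exact (((integrable_const _).add hz).const_mul _).mul_const _
  have h3 : ∫ z : ℝ, Complex.I * (u + z : ℝ) * x ∂(gaussianReal 0 1) = Complex.I * u * x := by
    push_cast
    rw [integral_mul_const, integral_const_mul, integral_add (integrable_const _) hz, hz0]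
    simp
  have h4 : Integrable (fun z : ℝ => Complex.exp (Complex.I * (u + z : ℝ) * x) - 1)
      (gaussianReal 0 1) := h1.sub (integrable_const _)
  have h5 : ∫ z : ℝ, (Complex.exp (Complex.I * (u + z : ℝ) * x) - 1) ∂(gaussianReal 0 1) =
      Complex.exp (Complex.I * u * x) * (Real.exp (-x ^ 2 / 2) : ℝ) - 1 := by
    rw [integral_sub h1 (integrable_const _), integral_exp_gaussian]
    simp
  unfold levyKernel gaussWeight
  split_ifs with hx
  · rw [integral_sub h4 h2, h3, h5]
    push_cast
    ring
  · simp_rw [sub_zero]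
    rw [h5]
    push_cast
    ring

/-- Averaging the Lévy–Khintchine exponent over a standard Gaussian shift subtracts the Fourier
transform of the finite measure `gaussWeight • ν + (b² / 2) • δ₀`. -/
theorem integral_levyExponent_gaussian (hν : IsLevyMeasure ν) (u : ℝ) :
    ∫ z : ℝ, levyExponent a b ν (u + z) ∂(gaussianReal 0 1) =
      levyExponent a b ν u - (∫ x : ℝ, Complex.exp (Complex.I * u * x) * (gaussWeight x : ℝ) ∂ν
        + (b : ℂ) ^ 2 / 2) := by
  have := hν.sFinite
  have hk : Integrable (Function.uncurry fun z x : ℝ => levyKernel (u + z) x)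
      ((gaussianReal 0 1).prod ν) := by
    refine (((integrable_one_add_sq_gaussian u).const_mul 3).mul_prod hν.integrable_min).mono'
      (measurable_levyKernel.comp (f := fun p : ℝ × ℝ => (u + p.1, p.2))
        (by fun_prop)).aestronglyMeasurable
      (.of_forall fun p => norm_levyKernel_le _ _)
  have hexp :
      Integrable (fun x : ℝ => Complex.exp (Complex.I * u * x) * (gaussWeight x : ℝ)) ν := by
    refine hν.integrable_min.mono' (by have := continuous_gaussWeight; fun_prop)
      (.of_forall fun x => ?_)
    rw [norm_mul, norm_exp_I_mul_mul, one_mul, Complex.norm_real, Real.norm_eq_abs,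
      abs_of_nonneg (gaussWeight_nonneg x)]
    exact gaussWeight_le_min x
  have hz := integrable_ofReal_gaussian
  have hz0 := integral_ofReal_gaussian
  have hz2 : Integrable (fun z : ℝ => (z : ℂ) ^ 2) (gaussianReal 0 1) := by
    have := ((memLp_id_gaussianReal (μ := 0) (v := 1) 2).integrable_sq).ofReal (𝕜 := ℂ)
    simpa using this
  have hz2' : ∫ z : ℝ, (z : ℂ) ^ 2 ∂(gaussianReal 0 1) = 1 := by
    have h1 := variance_eq_sub (memLp_id_gaussianReal (μ := 0) (v := 1) 2)
    rw [variance_id_gaussianReal] at h1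
    have h2 : ∫ z : ℝ, z ^ 2 ∂(gaussianReal 0 1) = 1 := by
      have h3 : ∫ x, id x ∂(gaussianReal 0 1) = 0 := integral_id_gaussianReal
      rw [h3] at h1
      simpa using h1.symm
    have : ∫ z : ℝ, (z : ℂ) ^ 2 ∂(gaussianReal 0 1) =
        ∫ z : ℝ, ((z ^ 2 : ℝ) : ℂ) ∂(gaussianReal 0 1) := by
      simp
    rw [this, integral_complex_ofReal, h2]; simp
  have hA : ∀ z : ℝ, levyExponent a b ν (u + z) =
      (Complex.I * a * u - (b : ℂ) ^ 2 * (u : ℂ) ^ 2 / 2) +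
      ((Complex.I * a - (b : ℂ) ^ 2 * u) * z + (-(b : ℂ) ^ 2 / 2) * (z : ℂ) ^ 2) +
        ∫ x, levyKernel (u + z) x ∂ν := by
    intro z
    have : levyExponent a b ν (u + z) = Complex.I * a * (u + z : ℝ)
      - (b : ℂ) ^ 2 * ((u + z : ℝ) : ℂ) ^ 2 / 2 + ∫ x, levyKernel (u + z) x ∂ν := rfl
    rw [this]; push_cast; ring
  simp_rw [hA]
  set c₀ := Complex.I * a * u - (b : ℂ) ^ 2 * (u : ℂ) ^ 2 / 2
  set c₁ := Complex.I * a - (b : ℂ) ^ 2 * u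
  set c₂ := -(b : ℂ) ^ 2 / 2
  have hq : Integrable (fun z : ℝ => c₁ * (z : ℂ) + c₂ * (z : ℂ) ^ 2) (gaussianReal 0 1) :=
    (hz.const_mul _).add (hz2.const_mul _)
  have hp : Integrable (fun z : ℝ => c₀ + (c₁ * (z : ℂ) + c₂ * (z : ℂ) ^ 2)) (gaussianReal 0 1) :=
    (integrable_const _).add hq
  have hk' : Integrable (fun z : ℝ => ∫ x, levyKernel (u + z) x ∂ν) (gaussianReal 0 1) :=
    hk.integral_prod_left
  rw [integral_add hp hk', integral_add (integrable_const _) hq,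
    integral_add (hz.const_mul _) (hz2.const_mul _),
    integral_const_mul, integral_const_mul, hz0, hz2', integral_integral_swap hk]
  simp_rw [integral_levyKernel_gaussian]
  rw [integral_sub (hν.integrable_levyKernel u) hexp]
  have : levyExponent a b ν u = Complex.I * a * u
      - (b : ℂ) ^ 2 * (u : ℂ) ^ 2 / 2 + ∫ x, levyKernel u x ∂ν := rfl
  rw [this]
  simp only [integral_const, probReal_univ, one_smul, c₀, c₂]
  ring

theorem integral_charFun_gaussian (μ : Measure ℝ) [IsProbabilityMeasure μ] (u : ℝ) :
    charFun μ u - ∫ z : ℝ, charFun μ (u + z) ∂(gaussianReal 0 1) =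
      ∫ x : ℝ, Complex.exp (Complex.I * u * x) * (gaussWeight x : ℝ) ∂μ := by
  have hc : ∀ v : ℝ, charFun μ v = ∫ x : ℝ, Complex.exp (Complex.I * v * x) ∂μ := fun v => by
    rw [charFun_apply_real]; congr 1; ext x; congr 1; ring
  have hi : Integrable (Function.uncurry fun z x : ℝ =>
      Complex.exp (Complex.I * (u + z : ℝ) * x)) ((gaussianReal 0 1).prod μ) :=
    (integrable_const (1 : ℝ)).mono' (by unfold Function.uncurry; fun_prop)
      (.of_forall fun p => (norm_exp_I_mul_mul _ _).le)
  have h1 : Integrable (fun x : ℝ => Complex.exp (Complex.I * u * x)) μ :=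
    (integrable_const (1 : ℝ)).mono' (by fun_prop) (.of_forall fun p => (norm_exp_I_mul_mul _ _).le)
  have h2 : Integrable (fun x : ℝ => Complex.exp (Complex.I * u * x) *
      (Real.exp (-x ^ 2 / 2) : ℝ)) μ := by
    refine (integrable_const (1 : ℝ)).mono' (by fun_prop) (.of_forall fun x => ?_)
    rw [norm_mul, norm_exp_I_mul_mul, one_mul, Complex.norm_real, Real.norm_eq_abs, Real.abs_exp]
    exact Real.exp_le_one_iff.2 (by nlinarith [sq_nonneg x])
  simp_rw [hc]
  rw [integral_integral_swap hi]
  simp_rw [integral_exp_gaussian]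
  rw [← integral_sub h1 h2]
  congr 1; ext x
  unfold gaussWeight; push_cast; ring

end Levy

/-! ### Small-time asymptotics of Lévy processes away from the origin -/

open BoundedContinuousFunction in
/-- Lévy's continuity theorem for finite measures with a nonzero limit. -/
theorem tendsto_integral_of_tendsto_charFun (G : ℕ → FiniteMeasure ℝ) (G₀ : FiniteMeasure ℝ)
    (h0 : G₀ ≠ 0)
    (h : ∀ u, Tendsto (fun m => charFun (G m : Measure ℝ) u) atTop
      (𝓝 (charFun (G₀ : Measure ℝ) u))) (f : ℝ →ᵇ ℝ) :
    Tendsto (fun m => ∫ x, f x ∂(G m : Measure ℝ)) atTop (𝓝 (∫ x, f x ∂(G₀ : Measure ℝ))) := by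
  have hmass : Tendsto (fun m => (G m).mass) atTop (𝓝 G₀.mass) := by
    have h1 := (Complex.continuous_re.tendsto _).comp (h 0)
    simp only [charFun_zero, Function.comp_def, Complex.ofReal_re] at h1
    exact NNReal.tendsto_coe.1 h1
  have hne : ∀ᶠ m in atTop, G m ≠ 0 := by
    filter_upwards [hmass.eventually_ne ((FiniteMeasure.mass_nonzero_iff _).2 h0)] with m hm
    exact (FiniteMeasure.mass_nonzero_iff _).1 hm
  have hchar : ∀ (H : FiniteMeasure ℝ), H ≠ 0 → ∀ u, charFun (H.normalize : Measure ℝ) u =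
      ((H.mass⁻¹ : ℝ≥0) : ℂ) * charFun (H : Measure ℝ) u := by
    intro H hH u
    rw [FiniteMeasure.toMeasure_normalize_eq_of_nonzero _ hH, charFun_apply_real,
      charFun_apply_real, integral_smul_nnreal_measure]
    rfl
  refine FiniteMeasure.tendsto_iff_forall_integral_tendsto.1
    (FiniteMeasure.tendsto_of_tendsto_normalize_testAgainstNN_of_tendsto_mass ?_ hmass) f
  refine ProbabilityMeasure.tendsto_iff_tendsto_charFun.2 fun u => ?_
  rw [hchar G₀ h0]
  refine Tendsto.congr' (f₁ := fun m => (((G m).mass⁻¹ : ℝ≥0) : ℂ) * charFun (G m : Measure ℝ) u)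
    ?_ (Tendsto.mul ?_ (h u))
  · filter_upwards [hne] with m hm using (hchar _ hm u).symm
  · have := hmass.inv₀ ((FiniteMeasure.mass_nonzero_iff _).2 h0)
    exact (Complex.continuous_ofReal.tendsto _).comp (NNReal.tendsto_coe.2 this)

theorem tendsto_mul_exp_inv_sub_one (z : ℂ) :
    Tendsto (fun m : ℕ => (m : ℂ) * (Complex.exp ((m : ℂ)⁻¹ * z) - 1)) atTop (𝓝 z) := by
  rw [tendsto_iff_norm_sub_tendsto_zero]
  refine squeeze_zero' (.of_forall fun _ => norm_nonneg _) ?_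
    (tendsto_const_div_atTop_nhds_zero_nat (‖z‖ ^ 2))
  filter_upwards [eventually_ge_atTop 1, eventually_ge_atTop ⌈‖z‖⌉₊] with m hm hz
  have hm0 : (0 : ℝ) < m := by exact_mod_cast hm
  have hmc : (m : ℂ) ≠ 0 := by exact_mod_cast hm0.ne'
  have hn : ‖(m : ℂ)⁻¹ * z‖ = ‖z‖ / m := by simp [div_eq_inv_mul]
  have hle : ‖(m : ℂ)⁻¹ * z‖ ≤ 1 := by
    rw [hn, div_le_one hm0]; exact (Nat.le_ceil _).trans (by exact_mod_cast hz)
  have key := Complex.norm_exp_sub_one_sub_id_le hle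
  calc ‖(m : ℂ) * (Complex.exp ((m : ℂ)⁻¹ * z) - 1) - z‖
      = m * ‖Complex.exp ((m : ℂ)⁻¹ * z) - 1 - (m : ℂ)⁻¹ * z‖ := by
        rw [← Complex.norm_natCast, ← norm_mul]; congr 1; field_simp
    _ ≤ m * (‖z‖ / m) ^ 2 := by rw [← hn]; gcongr
    _ = ‖z‖ ^ 2 / m := by field_simp

theorem norm_mul_exp_inv_sub_one_le {z : ℂ} (m : ℕ) (h : ‖Complex.exp ((m : ℂ)⁻¹ * z)‖ ≤ 1) :
    ‖(m : ℂ) * (Complex.exp ((m : ℂ)⁻¹ * z) - 1)‖ ≤ 2 * ‖z‖ := by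
  rcases Nat.eq_zero_or_pos m with rfl | hm
  · simp
  have hm0 : (0 : ℝ) < m := by exact_mod_cast hm
  have hn : ‖(m : ℂ)⁻¹ * z‖ = ‖z‖ / m := by simp [div_eq_inv_mul]
  have key : ‖Complex.exp ((m : ℂ)⁻¹ * z) - 1‖ ≤ 2 * (‖z‖ / m) := by
    rw [← hn]
    by_cases h1 : ‖(m : ℂ)⁻¹ * z‖ ≤ 1
    · exact Complex.norm_exp_sub_one_le h1
    · exact (norm_sub_le _ _).trans (by rw [norm_one]; linarith)
  rw [norm_mul, Complex.norm_natCast]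
  calc (m : ℝ) * ‖Complex.exp ((m : ℂ)⁻¹ * z) - 1‖ ≤ m * (2 * (‖z‖ / m)) := by gcongr
    _ = 2 * ‖z‖ := by field_simp

section Levy

variable {a b : ℝ} {ν : Measure ℝ} {μ : ℕ → Measure ℝ} [∀ m, IsProbabilityMeasure (μ m)]

theorem tendsto_mul_charFun_sub_integral (hν : IsLevyMeasure ν)
    (hμ : ∀ m u, charFun (μ m) u = Complex.exp ((m : ℂ)⁻¹ * levyExponent a b ν u)) (u : ℝ) :
    Tendsto (fun m : ℕ => (m : ℂ) * (charFun (μ m) u -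
        ∫ z : ℝ, charFun (μ m) (u + z) ∂(gaussianReal 0 1))) atTop
      (𝓝 (∫ x : ℝ, Complex.exp (Complex.I * u * x) * (gaussWeight x : ℝ) ∂ν
        + (b : ℂ) ^ 2 / 2)) := by
  obtain ⟨C, hC⟩ := hν.norm_levyExponent_le a b
  have hlim : Tendsto (fun m : ℕ => ∫ z : ℝ, (m : ℂ) * (charFun (μ m) (u + z) - 1)
      ∂(gaussianReal 0 1)) atTop (𝓝 (∫ z : ℝ, levyExponent a b ν (u + z) ∂(gaussianReal 0 1))) := by
    refine tendsto_integral_of_dominated_convergence (fun z => 2 * (C * (1 + (u + z) ^ 2)))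
      (fun m => ?_) (((integrable_one_add_sq_gaussian u).const_mul C).const_mul 2)
      (fun m => .of_forall fun z => ?_) (.of_forall fun z => ?_)
    · have := measurable_charFun (μ := μ m)
      fun_prop
    · have := norm_charFun_le_one (μ := μ m) (u + z)
      rw [hμ] at this ⊢
      exact (norm_mul_exp_inv_sub_one_le m this).trans (by gcongr; exact hC _)
    · simp_rw [hμ]
      exact tendsto_mul_exp_inv_sub_one _
  rw [integral_levyExponent_gaussian hν] at hlim
  have h1 := (tendsto_mul_exp_inv_sub_one (levyExponent a b ν u)).sub hlim
  rw [sub_sub_cancel] at h1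
  refine h1.congr fun m => ?_
  have hi : Integrable (fun z => charFun (μ m) (u + z)) (gaussianReal 0 1) := by
    refine (integrable_const (1 : ℝ)).mono' ?_ (.of_forall fun z => norm_charFun_le_one _)
    have := measurable_charFun (μ := μ m)
    fun_prop
  rw [integral_const_mul, integral_sub hi (integrable_const _), ← hμ]
  simp
  ring

open BoundedContinuousFunction in
/-- If `μ m` has the law at time `1 / m` of a Lévy process with Lévy measure `ν`, then
`m • μ m` converges to `ν` away from the origin. The finite measures
`gaussWeight • (m • μ m)` converge weakly by Lévy's continuity theorem, and a function vanishing
near the origin is a bounded continuous multiple of the weight. -/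
theorem tendsto_mul_integral_levyMeasure (hν : IsLevyMeasure ν) (hν0 : ν ≠ 0)
    (hμ : ∀ m u, charFun (μ m) u = Complex.exp ((m : ℂ)⁻¹ * levyExponent a b ν u))
    (f : ℝ →ᵇ ℝ) {r : ℝ} (hr : 0 < r) (hf : ∀ x, |x| ≤ r → f x = 0) :
    Tendsto (fun m : ℕ => (m : ℝ) * ∫ x, f x ∂(μ m)) atTop (𝓝 (∫ x, f x ∂ν)) := by
  set w : ℝ → ℝ≥0∞ := fun x => ENNReal.ofReal (gaussWeight x) with hw
  have hwm : Measurable w := continuous_gaussWeight.measurable.ennreal_ofReal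
  have hwt : ∀ x, (w x).toReal = gaussWeight x := fun x =>
    ENNReal.toReal_ofReal (gaussWeight_nonneg x)
  have hfin : ∀ m, IsFiniteMeasure ((μ m).withDensity w) := fun m => by
    refine isFiniteMeasure_withDensity (ne_top_of_le_ne_top (b := ∫⁻ _, 1 ∂(μ m)) (by simp) ?_)
    refine lintegral_mono fun x => ENNReal.ofReal_le_one.2 ?_
    exact (gaussWeight_le_min x).trans (min_le_left _ _)
  have hfin0 : IsFiniteMeasure (ν.withDensity w) := by
    refine isFiniteMeasure_withDensity (ne_top_of_le_ne_top hν.2.ne ?_)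
    exact lintegral_mono fun x => ENNReal.ofReal_le_ofReal (gaussWeight_le_min x)
  set G : ℕ → FiniteMeasure ℝ := fun m => (m : ℝ≥0) • ⟨(μ m).withDensity w, hfin m⟩ with hG
  set G₀ : FiniteMeasure ℝ := ⟨ν.withDensity w + (b ^ 2 / 2).toNNReal • Measure.dirac 0,
    inferInstance⟩ with hG₀
  have hGint : ∀ {E : Type} [NormedAddCommGroup E] [NormedSpace ℝ E] (m : ℕ) (h : ℝ → E),
      ∫ x, h x ∂(G m : Measure ℝ) = (m : ℝ) • ∫ x, gaussWeight x • h x ∂(μ m) := by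
    intro E _ _ m h
    have : (G m : Measure ℝ) = (m : ℝ≥0) • (μ m).withDensity w := rfl
    rw [this, integral_smul_nnreal_measure, integral_withDensity_eq_integral_toReal_smul hwm
      (.of_forall fun x => ENNReal.ofReal_lt_top)]
    simp_rw [hwt]
    rfl
  have hG₀int : ∀ {E : Type} [NormedAddCommGroup E] [NormedSpace ℝ E] [CompleteSpace E]
      (h : ℝ → E), Continuous h → (∃ C, ∀ x, ‖h x‖ ≤ C) →
      ∫ x, h x ∂(G₀ : Measure ℝ) = ∫ x, gaussWeight x • h x ∂ν + (b ^ 2 / 2) • h 0 := by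
    rintro E _ _ _ h hc ⟨C, hC⟩
    have : (G₀ : Measure ℝ) = ν.withDensity w + (b ^ 2 / 2).toNNReal • Measure.dirac 0 := rfl
    have hi : ∀ κ : Measure ℝ, IsFiniteMeasure κ → Integrable h κ := fun κ _ =>
      (integrable_const C).mono' hc.aestronglyMeasurable (.of_forall hC)
    rw [this, integral_add_measure (hi _ hfin0) (hi _ inferInstance), integral_smul_nnreal_measure,
      integral_dirac, integral_withDensity_eq_integral_toReal_smul hwm
      (.of_forall fun x => ENNReal.ofReal_lt_top)]
    simp_rw [hwt]
    rw [NNReal.smul_def, Real.coe_toNNReal _ (by positivity)]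
  have hne : G₀ ≠ 0 := by
    intro h
    have h1 : ν.withDensity w + (b ^ 2 / 2).toNNReal • Measure.dirac 0 = 0 :=
      congrArg Subtype.val h
    have h2 : ν.withDensity w = 0 :=
      le_antisymm (h1 ▸ Measure.le_add_right le_rfl) (Measure.zero_le _)
    rw [withDensity_eq_zero_iff hwm.aemeasurable] at h2
    have h3 : ∀ᵐ x ∂ν, x ∉ ({0} : Set ℝ) := measure_eq_zero_iff_ae_notMem.1 hν.1
    refine hν0 (ae_eq_bot.1 (eventually_false_iff_eq_bot.1 ?_))
    filter_upwards [h2, h3] with x hx hx0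
    have := gaussWeight_pos (x := x) (by simpa using hx0)
    simp only [hw, Pi.zero_apply, ENNReal.ofReal_eq_zero] at hx
    linarith
  have hconv : ∀ u, Tendsto (fun m => charFun (G m : Measure ℝ) u) atTop
      (𝓝 (charFun (G₀ : Measure ℝ) u)) := by
    intro u
    have hexp : ∀ x : ℝ, Complex.exp (u * x * Complex.I) = Complex.exp (Complex.I * u * x) :=
      fun x => by congr 1; ring
    simp_rw [charFun_apply_real, hexp, hGint]
    rw [hG₀int _ (by fun_prop) ⟨1, fun x => (norm_exp_I_mul_mul u x).le⟩]
    have := tendsto_mul_charFun_sub_integral hν hμ u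
    simp_rw [integral_charFun_gaussian] at this
    convert! this using 2 with m
    · simp [mul_comm]
    · simp [mul_comm]
  -- `h` is the quotient of `f` by the weight; the maximum only matters where `f` vanishes
  have hpos : ∀ x, 0 < max (gaussWeight x) (gaussWeight r) := fun x =>
    lt_max_of_lt_right (gaussWeight_pos hr.ne')
  set h : ℝ →ᵇ ℝ := BoundedContinuousFunction.ofNormedAddCommGroup
    (fun x => f x / max (gaussWeight x) (gaussWeight r))
    (f.continuous.div (continuous_gaussWeight.max continuous_const) fun x => (hpos x).ne')
    (‖f‖ / gaussWeight r) (fun x => by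
      rw [norm_div, Real.norm_of_nonneg (hpos x).le]
      have := f.norm_coe_le_norm x
      have := gaussWeight_pos hr.ne'
      gcongr
      exact le_max_right _ _) with hh
  have hhf : ∀ x, gaussWeight x • h x = f x := by
    intro x
    change gaussWeight x * (f x / max (gaussWeight x) (gaussWeight r)) = f x
    by_cases hx : |x| ≤ r
    · simp [hf x hx]
    · have h1 := gaussWeight_mono hr.le (not_le.1 hx).le
      rw [max_eq_left h1]
      have := (gaussWeight_pos hr.ne').trans_le h1
      field_simp
  have key := tendsto_integral_of_tendsto_charFun G G₀ hne hconv h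
  simp_rw [hGint] at key
  rw [hG₀int h h.continuous ⟨‖h‖, h.norm_coe_le_norm⟩] at key
  simp_rw [hhf] at key
  have h00 : h 0 = 0 := by
    change f 0 / _ = 0
    rw [hf 0 (by simpa using hr.le), zero_div]
  simpa [h00] using key

/-- A continuous version of the indicator of `[c, ∞)` vanishing on `(-∞, d]`. -/
def ramp (d c x : ℝ) : ℝ := max 0 (min 1 ((x - d) / (c - d)))

theorem continuous_ramp (d c : ℝ) : Continuous (ramp d c) := by
  unfold ramp; fun_prop

theorem ramp_nonneg (d c x : ℝ) : 0 ≤ ramp d c x := le_max_left _ _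

theorem ramp_le_one (d c x : ℝ) : ramp d c x ≤ 1 := max_le zero_le_one (min_le_left _ _)

theorem ramp_eq_zero {d c x : ℝ} (hdc : d < c) (hx : x ≤ d) : ramp d c x = 0 :=
  max_eq_left <| (min_le_right _ _).trans <|
    div_nonpos_of_nonpos_of_nonneg (by linarith) (by linarith)

theorem ramp_eq_one {d c x : ℝ} (hdc : d < c) (hx : c ≤ x) : ramp d c x = 1 := by
  have : 1 ≤ (x - d) / (c - d) := by rw [one_le_div (by linarith)]; linarith
  rw [ramp, min_eq_left this, max_eq_right zero_le_one]

open BoundedContinuousFunction in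
/-- `ramp d c (e x)` as a bounded continuous function of `x`. -/
def rampBCF (d c e : ℝ) : ℝ →ᵇ ℝ :=
  BoundedContinuousFunction.ofNormedAddCommGroup (fun x => ramp d c (e * x))
    ((continuous_ramp d c).comp (continuous_const.mul continuous_id)) 1
    (fun x => by rw [Real.norm_of_nonneg (ramp_nonneg _ _ _)]; exact ramp_le_one _ _ _)

theorem indicator_le_ramp {d c : ℝ} (hdc : d < c) (e x : ℝ) :
    indicator {x | c ≤ e * x} 1 x ≤ rampBCF d c e x := by
  change _ ≤ ramp d c (e * x)
  refine indicator_le' (fun x hx => (ramp_eq_one hdc hx).ge) (fun x _ => ramp_nonneg _ _ _) x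

theorem ramp_le_indicator {d c : ℝ} (hdc : d < c) (e x : ℝ) :
    rampBCF d c e x ≤ indicator {x | d ≤ e * x} 1 x := by
  change ramp d c (e * x) ≤ _
  by_cases hx : d ≤ e * x
  · rw [indicator_of_mem (by exact hx)]; exact ramp_le_one _ _ _
  · rw [indicator_of_notMem (by exact hx)]; exact (ramp_eq_zero hdc (not_le.1 hx).le).le

theorem measurableSet_halfLine (c e : ℝ) : MeasurableSet {x : ℝ | c ≤ e * x} :=
  measurableSet_le measurable_const (by fun_prop)

theorem IsLevyMeasure.measure_halfLine_lt_top (hν : IsLevyMeasure ν) {e c : ℝ} (he : |e| = 1)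
    (hc : 0 < c) : ν {x | c ≤ e * x} < ∞ := by
  have h := hν.integrable_min.measure_norm_ge_lt_top (ε := min 1 (c ^ 2)) (by positivity)
  refine (measure_mono fun x hx => ?_).trans_lt h
  have : c ≤ |x| := by
    calc c ≤ e * x := hx
      _ ≤ |e * x| := le_abs_self _
      _ = |x| := by rw [abs_mul, he, one_mul]
  change min 1 (c ^ 2) ≤ ‖min 1 (x ^ 2)‖
  rw [Real.norm_of_nonneg (by positivity), ← sq_abs x]
  gcongr

/-- Half-line probabilities at small times are squeezed by integrals of a ramp, which converge. -/
theorem exists_tendsto_halfLine (hν : IsLevyMeasure ν) (hν0 : ν ≠ 0)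
    (hμ : ∀ m u, charFun (μ m) u = Complex.exp ((m : ℂ)⁻¹ * levyExponent a b ν u))
    {e d c : ℝ} (he : |e| = 1) (hd : 0 < d) (hdc : d < c) :
    ∃ L, ν.real {x | c ≤ e * x} ≤ L ∧ L ≤ ν.real {x | d ≤ e * x} ∧
      ∃ J : ℕ → ℝ, Tendsto (fun m => m * J m) atTop (𝓝 L) ∧
        ∀ m, (μ m).real {x | c ≤ e * x} ≤ J m ∧ J m ≤ (μ m).real {x | d ≤ e * x} := by
  have hsq : ∀ κ : Measure ℝ, κ {x | d ≤ e * x} < ∞ → κ {x | c ≤ e * x} < ∞ →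
      κ.real {x | c ≤ e * x} ≤ ∫ x, rampBCF d c e x ∂κ ∧
      ∫ x, rampBCF d c e x ∂κ ≤ κ.real {x | d ≤ e * x} := by
    intro κ h1 h2
    have i1 : Integrable (indicator {x | d ≤ e * x} (1 : ℝ → ℝ)) κ :=
      (integrable_indicator_iff (measurableSet_halfLine _ _)).2 (integrableOn_const h1.ne)
    have i2 : Integrable (indicator {x | c ≤ e * x} (1 : ℝ → ℝ)) κ :=
      (integrable_indicator_iff (measurableSet_halfLine _ _)).2 (integrableOn_const h2.ne)
    have i3 : Integrable (rampBCF d c e) κ :=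
      i1.mono' (rampBCF d c e).continuous.aestronglyMeasurable (.of_forall fun x => by
        have : 0 ≤ rampBCF d c e x := ramp_nonneg _ _ _
        rw [Real.norm_of_nonneg this]
        exact ramp_le_indicator hdc e x)
    rw [← integral_indicator_one (measurableSet_halfLine c e),
      ← integral_indicator_one (measurableSet_halfLine d e)]
    exact ⟨integral_mono i2 i3 (indicator_le_ramp hdc e),
      integral_mono i3 i1 (ramp_le_indicator hdc e)⟩
  have h0 := hsq ν (hν.measure_halfLine_lt_top he hd)
    (hν.measure_halfLine_lt_top he (hd.trans hdc))
  refine ⟨_, h0.1, h0.2, _, tendsto_mul_integral_levyMeasure hν hν0 hμ (rampBCF d c e) hd ?_,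
    fun m => hsq _ (measure_lt_top _ _) (measure_lt_top _ _)⟩
  intro x hx
  refine ramp_eq_zero hdc ?_
  calc e * x ≤ |e * x| := le_abs_self _
    _ = |x| := by rw [abs_mul, he, one_mul]
    _ ≤ d := hx

/-- The law at time `1 / m` charges `[c, ∞)` with at most about `ν [d, ∞) / m`, for `d < c`. -/
theorem eventually_mul_halfLine_le (hν : IsLevyMeasure ν) (hν0 : ν ≠ 0)
    (hμ : ∀ m u, charFun (μ m) u = Complex.exp ((m : ℂ)⁻¹ * levyExponent a b ν u))
    {e d c : ℝ} (he : |e| = 1) (hd : 0 < d) (hdc : d < c) {ε : ℝ} (hε : 0 < ε) :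
    ∀ᶠ m : ℕ in atTop, m * (μ m).real {x | c ≤ e * x} ≤ ν.real {x | d ≤ e * x} + ε := by
  obtain ⟨L, -, hL, J, hJ, hb⟩ := exists_tendsto_halfLine hν hν0 hμ he hd hdc
  filter_upwards [hJ.eventually_le_const (u := L + ε) (by linarith)] with m hm
  have : m * (μ m).real {x | c ≤ e * x} ≤ m * J m := by gcongr; exact (hb m).1
  linarith

/-- The law at time `1 / m` charges `[d, ∞)` with at least about `ν [c, ∞) / m`, for `d < c`. -/
theorem eventually_le_mul_halfLine (hν : IsLevyMeasure ν) (hν0 : ν ≠ 0)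
    (hμ : ∀ m u, charFun (μ m) u = Complex.exp ((m : ℂ)⁻¹ * levyExponent a b ν u))
    {e d c : ℝ} (he : |e| = 1) (hd : 0 < d) (hdc : d < c) {ε : ℝ} (hε : 0 < ε) :
    ∀ᶠ m : ℕ in atTop, ν.real {x | c ≤ e * x} - ε ≤ m * (μ m).real {x | d ≤ e * x} := by
  obtain ⟨L, hL, -, J, hJ, hb⟩ := exists_tendsto_halfLine hν hν0 hμ he hd hdc
  filter_upwards [hJ.eventually_const_le (u := L - ε) (by linarith)] with m hm
  have : m * J m ≤ m * (μ m).real {x | d ≤ e * x} := by gcongr; exact (hb m).2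
  linarith

end Levy

/-! ### Jumps of càdlàg paths and increments over grids -/

/-- The jump `x(t) - x(t-)` of a path with time set `[0, ∞)`. -/
def pathJump (x : ℝ≥0 → ℝ) (t : ℝ≥0) : ℝ := x t - Function.leftLim x t

/-- The increment of a path over the grid interval `(i / m, (i + 1) / m]`. -/
def gridIncrement (x : ℝ≥0 → ℝ) (m i : ℕ) : ℝ := x ((i + 1 : ℕ) / m) - x (i / m)

/-- The index of the grid interval `(i / m, (i + 1) / m]` that contains `t > 0`. -/
def gridIndex (m : ℕ) (t : ℝ≥0) : ℕ := ⌈t * m⌉₊ - 1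

theorem gridIndex_add_one {m : ℕ} (hm : 0 < m) {t : ℝ≥0} (ht : 0 < t) :
    gridIndex m t + 1 = ⌈t * m⌉₊ := by
  have : 0 < ⌈t * m⌉₊ := Nat.ceil_pos.2 (mul_pos ht (by exact_mod_cast hm))
  unfold gridIndex; omega

theorem gridIndex_div_lt {m : ℕ} (hm : 0 < m) {t : ℝ≥0} (ht : 0 < t) :
    (gridIndex m t : ℝ≥0) / m < t := by
  rw [div_lt_iff₀ (by exact_mod_cast hm)]
  exact Nat.lt_ceil.1 (by have := gridIndex_add_one hm ht; omega)

theorem le_gridIndex_add_one_div {m : ℕ} (hm : 0 < m) {t : ℝ≥0} (ht : 0 < t) :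
    t ≤ ((gridIndex m t + 1 : ℕ) : ℝ≥0) / m := by
  rw [le_div_iff₀ (by exact_mod_cast hm), gridIndex_add_one hm ht]
  exact Nat.le_ceil _

theorem gridIndex_lt {m n : ℕ} (hm : 0 < m) {t : ℝ≥0} (ht : 0 < t) (htn : t ≤ n) :
    gridIndex m t < n * m := by
  have h : ⌈t * m⌉₊ ≤ n * m := Nat.ceil_le.2 (by push_cast; gcongr)
  have := gridIndex_add_one hm ht
  omega

theorem grid_succ_div (m i : ℕ) : ((i + 1 : ℕ) : ℝ≥0) / m = i / m + 1 / m := by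
  push_cast; rw [add_div]

theorem tendsto_one_div_nnreal : Tendsto (fun m : ℕ => (1 : ℝ≥0) / m) atTop (𝓝 0) := by
  rw [← NNReal.tendsto_coe]
  simpa using tendsto_one_div_atTop_nhds_zero_nat (𝕜 := ℝ)

theorem tendsto_gridIndex_div {t : ℝ≥0} (ht : 0 < t) :
    Tendsto (fun m => (gridIndex m t : ℝ≥0) / m) atTop (𝓝 t) := by
  have h : Tendsto (fun m : ℕ => t - 1 / m) atTop (𝓝 t) := by
    simpa using tendsto_const_nhds.sub tendsto_one_div_nnreal
  refine tendsto_of_tendsto_of_tendsto_of_le_of_le' h tendsto_const_nhds ?_ ?_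
  · filter_upwards [eventually_gt_atTop 0] with m hm
    rw [tsub_le_iff_right, ← grid_succ_div]
    exact le_gridIndex_add_one_div hm ht
  · filter_upwards [eventually_gt_atTop 0] with m hm using (gridIndex_div_lt hm ht).le

theorem tendsto_gridIndex_add_one_div {t : ℝ≥0} (ht : 0 < t) :
    Tendsto (fun m => ((gridIndex m t + 1 : ℕ) : ℝ≥0) / m) atTop (𝓝 t) := by
  simp_rw [grid_succ_div]
  simpa using (tendsto_gridIndex_div ht).add tendsto_one_div_nnreal

theorem eventually_gridIndex_ne {s t : ℝ≥0} (hs : 0 < s) (ht : 0 < t) (hst : s ≠ t) :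
    ∀ᶠ m in atTop, gridIndex m s ≠ gridIndex m t := by
  rcases hst.lt_or_gt with h | h
  · filter_upwards [(tendsto_gridIndex_div hs).eventually_lt (tendsto_gridIndex_div ht) h]
      with m hm heq
    exact hm.ne (by rw [heq])
  · filter_upwards [(tendsto_gridIndex_div ht).eventually_lt (tendsto_gridIndex_div hs) h]
      with m hm heq
    exact hm.ne (by rw [heq])

/-- A jump is the limit of the increments over the grid intervals that contain it. -/
theorem IsCadlag.eventually_gridIncrement_mem {x : ℝ≥0 → ℝ} (hx : IsCadlag x) {t : ℝ≥0}
    (ht : 0 < t) {U : Set ℝ} (hU : IsOpen U) (h : pathJump x t ∈ U) :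
    ∀ᶠ m in atTop, gridIncrement x m (gridIndex m t) ∈ U := by
  have h1 : Tendsto (fun m => ((gridIndex m t + 1 : ℕ) : ℝ≥0) / m) atTop (𝓝[≥] t) :=
    tendsto_nhdsWithin_iff.2 ⟨tendsto_gridIndex_add_one_div ht, by
      filter_upwards [eventually_gt_atTop 0] with m hm using le_gridIndex_add_one_div hm ht⟩
  have h2 : Tendsto (fun m => (gridIndex m t : ℝ≥0) / m) atTop (𝓝[<] t) :=
    tendsto_nhdsWithin_iff.2 ⟨tendsto_gridIndex_div ht, by
      filter_upwards [eventually_gt_atTop 0] with m hm using gridIndex_div_lt hm ht⟩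
  have h3 := ((hx t).1.tendsto.comp h1).sub ((tendsto_leftLim_of_tendsto (hx t).2).comp h2)
  exact h3.eventually (hU.mem_nhds h)

/-- Near a time `t`, increments of a càdlàg path are close to `0` or to the jump at `t`; the latter
only occurs for intervals starting before `t`. -/
theorem IsCadlag.exists_open_sub_notMem {x : ℝ≥0 → ℝ} (hx : IsCadlag x) {C : Set ℝ}
    (hC : IsClosed C) (h0 : (0 : ℝ) ∉ C) {p t : ℝ≥0}
    (h : p < t → pathJump x t ∉ C) :
    ∃ V, IsOpen V ∧ t ∈ V ∧ ∀ u ∈ V, ∀ v ∈ V, p ≤ u → u ≤ v → x v - x u ∉ C := by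
  have hball : ∀ y ∉ C, ∃ ε > 0, ∀ z, |z - y| < ε → z ∉ C := by
    intro y hy
    obtain ⟨ε, hε, hb⟩ := Metric.isOpen_iff.1 hC.isOpen_compl y hy
    exact ⟨ε, hε, fun z hz => hb (by rwa [Metric.mem_ball, Real.dist_eq])⟩
  obtain ⟨ε₁, hε₁, hb₁⟩ := hball 0 h0
  obtain ⟨ε₂, hε₂, hb₂⟩ : ∃ ε > 0, p < t → ∀ z, |z - pathJump x t| < ε → z ∉ C := by
    by_cases hp : p < t
    · obtain ⟨ε, hε, hb⟩ := hball _ (h hp)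
      exact ⟨ε, hε, fun _ => hb⟩
    · exact ⟨1, one_pos, fun h => absurd h hp⟩
  set ε := min ε₁ ε₂ / 2 with hεdef
  have hε : 0 < ε := by positivity
  have hε1 : ε + ε ≤ ε₁ := by rw [hεdef]; linarith [min_le_left ε₁ ε₂]
  have hε2 : ε + ε ≤ ε₂ := by rw [hεdef]; linarith [min_le_right ε₁ ε₂]
  have hr : ∀ᶠ u in 𝓝 t, u ∈ Ici t → |x u - x t| < ε := by
    rw [← eventually_nhdsWithin_iff]
    simpa [Real.dist_eq] using Metric.tendsto_nhds.1 (hx t).1.tendsto ε hε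
  have hl : ∀ᶠ u in 𝓝 t, u ∈ Iio t → |x u - Function.leftLim x t| < ε := by
    rw [← eventually_nhdsWithin_iff]
    simpa [Real.dist_eq] using Metric.tendsto_nhds.1 (tendsto_leftLim_of_tendsto (hx t).2) ε hε
  obtain ⟨V, hV, hVo, htV⟩ := eventually_nhds_iff.1 (hr.and hl)
  refine ⟨V, hVo, htV, fun u hu v hv hpu huv => ?_⟩
  rcases lt_or_ge u t with hut | hut
  · have h1 := (hV u hu).2 hut
    rcases lt_or_ge v t with hvt | hvt
    · have h2 := (hV v hv).2 hvt
      refine hb₁ _ ?_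
      rw [abs_lt] at h1 h2 ⊢
      constructor <;> linarith
    · have h2 := (hV v hv).1 hvt
      refine hb₂ (hpu.trans_lt hut) _ ?_
      unfold pathJump
      rw [abs_lt] at h1 h2 ⊢
      constructor <;> linarith
  · have h1 := (hV u hu).1 hut
    have h2 := (hV v hv).1 (le_trans hut huv)
    refine hb₁ _ ?_
    rw [abs_lt] at h1 h2 ⊢
    constructor <;> linarith

/-- If on arbitrarily fine grids some increment lies in a closed set that avoids `0`, then some jump
lies in this set. -/
theorem IsCadlag.exists_pathJump_mem {x : ℝ≥0 → ℝ} (hx : IsCadlag x) {C : Set ℝ}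
    (hC : IsClosed C) (h0 : (0 : ℝ) ∉ C) {p q : ℕ}
    (h : ∃ᶠ m in atTop, ∃ i, p * m ≤ i ∧ i < q * m ∧ gridIncrement x m i ∈ C) :
    ∃ t : ℝ≥0, p < t ∧ t ≤ q ∧ pathJump x t ∈ C := by
  by_contra! hcon
  have hV : ∀ t : Icc (p : ℝ≥0) q, ∃ V, IsOpen V ∧ (t : ℝ≥0) ∈ V ∧
      ∀ u ∈ V, ∀ v ∈ V, (p : ℝ≥0) ≤ u → u ≤ v → x v - x u ∉ C := fun t =>
    hx.exists_open_sub_notMem hC h0 fun hp => hcon t hp t.2.2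
  choose V hVo hVt hVC using hV
  obtain ⟨δ, hδ, hball⟩ := lebesgue_number_lemma_of_metric (isCompact_Icc (a := (p : ℝ≥0)) (b := q))
    hVo (fun t ht => mem_iUnion.2 ⟨⟨t, ht⟩, hVt _⟩)
  obtain ⟨m, ⟨i, hpi, hiq, hi⟩, hm0, hmδ⟩ := (h.and_eventually ((eventually_gt_atTop 0).and
    (tendsto_one_div_nnreal.eventually (Metric.ball_mem_nhds _ hδ)))).exists
  have hm : (0 : ℝ≥0) < m := by exact_mod_cast hm0
  have hp : (p : ℝ≥0) ≤ i / m := by rw [le_div_iff₀ hm]; exact_mod_cast hpi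
  have hq : (i : ℝ≥0) / m ≤ q := by rw [div_le_iff₀ hm]; exact_mod_cast hiq.le
  obtain ⟨t, ht⟩ := hball (i / m) ⟨hp, hq⟩
  have hmem : ((i + 1 : ℕ) : ℝ≥0) / m ∈ Metric.ball ((i : ℝ≥0) / m) δ := by
    rw [grid_succ_div, Metric.mem_ball, NNReal.dist_eq]
    rw [NNReal.dist_eq] at hmδ
    simpa using hmδ
  refine hVC t _ (ht (Metric.mem_ball_self hδ)) _ (ht hmem) hp ?_ hi
  gcongr
  omega

/-! ### Probabilities of two jumps of a Lévy process -/

/-- A form of Fatou's lemma that needs no measurability. -/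
theorem measure_setOf_eventually_le {Ω : Type*} [MeasurableSpace Ω] (P : Measure Ω)
    {E : ℕ → Set Ω} {K : ℝ≥0∞} (h : ∀ᶠ m in atTop, P (E m) ≤ K) :
    P {ω | ∀ᶠ m in atTop, ω ∈ E m} ≤ K := by
  have heq : {ω | ∀ᶠ m in atTop, ω ∈ E m} = ⋃ N, ⋂ m ≥ N, E m := by
    ext ω; simp [eventually_atTop]
  have hmono : Monotone fun N => ⋂ m ≥ N, E m := fun N N' hN =>
    biInter_subset_biInter_left fun m (hm : N' ≤ m) => hN.trans hm
  rw [heq, hmono.measure_iUnion]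
  refine iSup_le fun N => ?_
  obtain ⟨m, hm, hmN⟩ := (h.and (eventually_ge_atTop N)).exists
  exact (measure_mono (biInter_subset_of_mem hmN)).trans hm

theorem le_measure_setOf_frequently {Ω : Type*} [MeasurableSpace Ω] (P : Measure Ω)
    [IsFiniteMeasure P] {E : ℕ → Set Ω} (hE : ∀ m, MeasurableSet (E m)) {K : ℝ≥0∞}
    (h : ∀ᶠ m in atTop, K ≤ P (E m)) : K ≤ P {ω | ∃ᶠ m in atTop, ω ∈ E m} := by
  have heq : {ω | ∃ᶠ m in atTop, ω ∈ E m} = ⋂ N, ⋃ m ≥ N, E m := by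
    ext ω; simp [frequently_atTop]
  have hanti : Antitone fun N => ⋃ m ≥ N, E m := fun N N' hN =>
    biUnion_subset_biUnion_left fun m (hm : N' ≤ m) => hN.trans hm
  rw [heq, hanti.measure_iInter
    (fun N => (MeasurableSet.biUnion (to_countable _) fun m _ => hE m).nullMeasurableSet)
    ⟨0, measure_ne_top _ _⟩]
  refine le_iInf fun N => ?_
  obtain ⟨m, hm, hmN⟩ := (h.and (eventually_ge_atTop N)).exists
  exact hm.trans (measure_mono (subset_biUnion_of_mem (u := E) hmN))

section Family

variable {Ω : Type*} [MeasurableSpace Ω] {P : Measure Ω} {D : ℕ → Ω → ℝ} {μ : Measure ℝ}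

theorem measure_exists_pair_le (hD : iIndepFun D P)
    (hμ : ∀ i, ∀ B, MeasurableSet B → P (D i ⁻¹' B) = μ B) {B B' : Set ℝ} (hB : MeasurableSet B)
    (hB' : MeasurableSet B') (N : ℕ) :
    P {ω | ∃ i < N, ∃ j < N, i ≠ j ∧ D i ω ∈ B ∧ D j ω ∈ B'} ≤ N ^ 2 * (μ B * μ B') := by
  have hsub : {ω | ∃ i < N, ∃ j < N, i ≠ j ∧ D i ω ∈ B ∧ D j ω ∈ B'} ⊆
      ⋃ i ∈ Finset.range N, ⋃ j ∈ Finset.range N,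
        {ω | i ≠ j ∧ D i ω ∈ B ∧ D j ω ∈ B'} := by
    rintro ω ⟨i, hi, j, hj, h⟩
    simp only [mem_iUnion, Finset.mem_range]
    exact ⟨i, hi, j, hj, h⟩
  have hterm : ∀ i j, P {ω | i ≠ j ∧ D i ω ∈ B ∧ D j ω ∈ B'} ≤ μ B * μ B' := by
    intro i j
    by_cases hij : i = j
    · simp [hij]
    · have := (hD.indepFun hij).measure_inter_preimage_eq_mul _ _ hB hB'
      rw [hμ _ _ hB, hμ _ _ hB'] at this
      rw [← this]
      exact measure_mono fun ω h => h.2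
  calc _ ≤ _ := measure_mono hsub
    _ ≤ ∑ i ∈ Finset.range N, ∑ j ∈ Finset.range N, μ B * μ B' :=
        (measure_biUnion_finset_le _ _).trans (Finset.sum_le_sum fun i _ =>
          (measure_biUnion_finset_le _ _).trans (Finset.sum_le_sum fun j _ => hterm i j))
    _ = _ := by simp [sq, mul_assoc]

theorem measure_exists_mem_ge [IsProbabilityMeasure P] [IsProbabilityMeasure μ]
    (hD : iIndepFun D P) (hDm : ∀ i, Measurable (D i))
    (hμ : ∀ i, ∀ B, MeasurableSet B → P (D i ⁻¹' B) = μ B) {B : Set ℝ} (hB : MeasurableSet B)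
    (S : Finset ℕ) {u : ℝ} (hu : u ≤ S.card * μ.real B) :
    ENNReal.ofReal (1 - Real.exp (-u)) ≤ P {ω | ∃ i ∈ S, D i ω ∈ B} := by
  have hm : MeasurableSet {ω | ∃ i ∈ S, D i ω ∈ B} := by
    have : {ω | ∃ i ∈ S, D i ω ∈ B} = ⋃ i ∈ S, D i ⁻¹' B := by ext; simp
    rw [this]
    exact S.measurableSet_biUnion fun i _ => hDm i hB
  have hc : {ω | ∃ i ∈ S, D i ω ∈ B}ᶜ = ⋂ i ∈ S, D i ⁻¹' Bᶜ := by ext; simp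
  have h1 : P.real {ω | ∃ i ∈ S, D i ω ∈ B}ᶜ = (1 - μ.real B) ^ S.card := by
    rw [hc, measureReal_def, hD.measure_inter_preimage_eq_mul S (fun i _ => hB.compl),
      Finset.prod_congr rfl (fun i _ => hμ i _ hB.compl), Finset.prod_const, ENNReal.toReal_pow,
      ← measureReal_def, probReal_compl_eq_one_sub hB]
  have h2 : P.real {ω | ∃ i ∈ S, D i ω ∈ B} = 1 - (1 - μ.real B) ^ S.card := by
    rw [← h1, probReal_compl_eq_one_sub hm]; ring
  rw [← ENNReal.ofReal_toReal (measure_ne_top P _), ← measureReal_def, h2]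
  refine ENNReal.ofReal_le_ofReal (sub_le_sub_left ?_ _)
  calc (1 - μ.real B) ^ S.card ≤ Real.exp (-μ.real B) ^ S.card := by
        have : 0 ≤ 1 - μ.real B := by linarith [measureReal_le_one (μ := μ) (s := B)]
        gcongr
        exact Real.one_sub_le_exp_neg _
    _ = Real.exp (-(S.card * μ.real B)) := by rw [← Real.exp_nat_mul]; congr 1; ring
    _ ≤ Real.exp (-u) := by gcongr

theorem measure_exists_and_exists (hD : iIndepFun D P) (hDm : ∀ i, Measurable (D i))
    {B B' : Set ℝ} (hB : MeasurableSet B) (hB' : MeasurableSet B') {S T : Finset ℕ}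
    (hST : Disjoint S T) :
    P {ω | (∃ i ∈ S, D i ω ∈ B) ∧ ∃ j ∈ T, D j ω ∈ B'} =
      P {ω | ∃ i ∈ S, D i ω ∈ B} * P {ω | ∃ j ∈ T, D j ω ∈ B'} := by
  have hmeas : ∀ (S : Finset ℕ) {B : Set ℝ}, MeasurableSet B →
      MeasurableSet {f : S → ℝ | ∃ i, f i ∈ B} := fun S B hB => by
    have : {f : S → ℝ | ∃ i, f i ∈ B} = ⋃ i, (fun f : S → ℝ => f i) ⁻¹' B := by ext; simp
    rw [this]
    exact MeasurableSet.iUnion fun i => measurable_pi_apply i hB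
  have h := (hD.indepFun_finset S T hST hDm).measure_inter_preimage_eq_mul _ _
    (hmeas S hB) (hmeas T hB')
  simpa [preimage, ofPred_and] using h

end Family

section Levy

variable {Ω : Type*} [MeasurableSpace Ω] {P : Measure Ω} {X : ℝ≥0 → Ω → ℝ} {a b : ℝ} {ν : Measure ℝ}

theorem IsLevyProcess.measurable_gridIncrement (hX : IsLevyProcess X P) (m i : ℕ) :
    Measurable fun ω => gridIncrement (fun t => X t ω) m i :=
  (hX.measurable _).sub (hX.measurable _)

theorem IsLevyProcess.iIndepFun_gridIncrement (hX : IsLevyProcess X P) (m : ℕ) :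
    iIndepFun (fun i ω => gridIncrement (fun t => X t ω) m i) P :=
  hX.indep.nat (t := fun i : ℕ => (i : ℝ≥0) / m) fun i j hij => by
    show (i : ℝ≥0) / m ≤ j / m
    gcongr

theorem IsLevyProcess.measure_gridIncrement_preimage (hX : IsLevyProcess X P) (m i : ℕ) (B : Set ℝ)
    (hB : MeasurableSet B) :
    P ((fun ω => gridIncrement (fun t => X t ω) m i) ⁻¹' B) = P.map (X (1 / m)) B := by
  have h := hX.stationary (i / m) (1 / m)
  rw [← grid_succ_div] at h
  rw [Measure.map_apply (hX.measurable _) hB]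
  exact h.measure_mem_eq hB

theorem HasLevyTriplet.charFun_map_one_div (hν : HasLevyTriplet X P a b ν) (m : ℕ) (u : ℝ) :
    charFun (P.map (X (1 / m))) u = Complex.exp ((m : ℂ)⁻¹ * levyExponent a b ν u) := by
  rw [hν.2]; simp

/-- Bound for two large jumps at distinct times of `(0, n]`, the second in the direction of the sign
`e`. On fine grids the two jumps lie in different cells, and a union bound over the pairs of cells
with independence of the increments gives the product of the two tails. -/
theorem measure_exists_two_jumps_le [IsProbabilityMeasure P] (hX : IsLevyProcess X P)
    (hν : HasLevyTriplet X P a b ν)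
    (hν0 : ν ≠ 0) {e c c' d d' : ℝ} (he : |e| = 1) (hd : 0 < d) (hdc : d < c) (hd' : 0 < d')
    (hdc' : d' < c') {u u' : ℝ} (hu : ν.real {x | d ≤ x} < u) (hu' : ν.real {x | d' ≤ e * x} < u')
    (n : ℕ) :
    P {ω | ∃ s t : ℝ≥0, 0 < s ∧ s ≤ n ∧ 0 < t ∧ t ≤ n ∧ s ≠ t ∧
      c < pathJump (fun t => X t ω) s ∧ c' < e * pathJump (fun t => X t ω) t} ≤
      ENNReal.ofReal (n ^ 2 * (u * u')) := by
  set D : ℕ → ℕ → Ω → ℝ := fun m i ω => gridIncrement (fun t => X t ω) m i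
  set B : Set ℝ := {x | c ≤ 1 * x}
  set B' : Set ℝ := {x | c' ≤ e * x}
  have hprob : ∀ m : ℕ, IsProbabilityMeasure (P.map (X (1 / m))) := fun m =>
    Measure.isProbabilityMeasure_map (hX.measurable _).aemeasurable
  refine (measure_mono ?_).trans (measure_setOf_eventually_le P
    (E := fun m => {ω | ∃ i < n * m, ∃ j < n * m, i ≠ j ∧ D m i ω ∈ B ∧ D m j ω ∈ B'}) ?_)
  · rintro ω ⟨s, t, hs, hsn, ht, htn, hst, hcs, hct⟩
    have h1 := (hX.cadlag ω).eventually_gridIncrement_mem hs (isOpen_Ioi (a := c)) hcs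
    have h2 := (hX.cadlag ω).eventually_gridIncrement_mem ht
      (isOpen_lt (continuous_const (y := c')) (continuous_const.mul continuous_id) :
        IsOpen {x : ℝ | c' < e * x}) hct
    filter_upwards [h1, h2, eventually_gridIndex_ne hs ht hst, eventually_gt_atTop 0]
      with m hm1 hm2 hne hm
    refine ⟨_, gridIndex_lt hm hs hsn, _, gridIndex_lt hm ht htn, hne, ?_, le_of_lt hm2⟩
    change c ≤ 1 * _
    rw [one_mul]
    exact le_of_lt hm1
  · have hu1 : ν.real {x | d ≤ 1 * x} < u := by simpa using hu
    filter_upwards [eventually_mul_halfLine_le hν.1 hν0 hν.charFun_map_one_div abs_one hd hdc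
        (sub_pos.2 hu1), eventually_mul_halfLine_le hν.1 hν0 hν.charFun_map_one_div he hd' hdc'
        (sub_pos.2 hu')] with m h1 h2
    rw [add_sub_cancel] at h1 h2
    refine (measure_exists_pair_le (hX.iIndepFun_gridIncrement m)
      (hX.measure_gridIncrement_preimage m) (measurableSet_halfLine _ _)
      (measurableSet_halfLine _ _) _).trans ?_
    rw [← ENNReal.ofReal_toReal (measure_ne_top (P.map (X (1 / m))) B),
      ← ENNReal.ofReal_toReal (measure_ne_top (P.map (X (1 / m))) B'), ← measureReal_def,
      ← measureReal_def, ← ENNReal.ofReal_mul measureReal_nonneg, ← ENNReal.ofReal_natCast,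
      ← ENNReal.ofReal_pow (by positivity), ← ENNReal.ofReal_mul (by positivity)]
    refine ENNReal.ofReal_le_ofReal ?_
    have h0 : 0 ≤ u := measureReal_nonneg.trans hu.le
    calc ((n * m : ℕ) : ℝ) ^ 2 * ((P.map (X (1 / m))).real B * (P.map (X (1 / m))).real B')
        = n ^ 2 * ((m * (P.map (X (1 / m))).real B) * (m * (P.map (X (1 / m))).real B')) := by
          push_cast; ring
      _ ≤ n ^ 2 * (u * u') := by gcongr

/-- With one jump sought in `(0, 1]` and the other in `(1, n]`, independence gives a product. -/
theorem le_measure_exists_two_jumps [IsProbabilityMeasure P] (hX : IsLevyProcess X P)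
    (hν : HasLevyTriplet X P a b ν)
    (hν0 : ν ≠ 0) {e c c' d d' : ℝ} (he : |e| = 1) (hc : 0 < c) (hcd : c < d) (hc' : 0 < c')
    (hcd' : c' < d') {u u' : ℝ} (hu : u < ν.real {x | d ≤ x}) (hu' : u' < ν.real {x | d' ≤ e * x})
    {n : ℕ} (hn : 1 ≤ n) :
    ENNReal.ofReal (1 - Real.exp (-((n - 1) * u))) * ENNReal.ofReal (1 - Real.exp (-u')) ≤
    P {ω | ∃ s t : ℝ≥0, 0 < s ∧ s ≤ n ∧ 0 < t ∧ t ≤ n ∧ s ≠ t ∧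
      c ≤ pathJump (fun t => X t ω) s ∧ c' ≤ e * pathJump (fun t => X t ω) t} := by
  set D : ℕ → ℕ → Ω → ℝ := fun m i ω => gridIncrement (fun t => X t ω) m i
  set B : Set ℝ := {x | c ≤ 1 * x}
  set B' : Set ℝ := {x | c' ≤ e * x}
  have hB : MeasurableSet B := measurableSet_halfLine _ _
  have hB' : MeasurableSet B' := measurableSet_halfLine _ _
  have hclosed : ∀ c e : ℝ, IsClosed {x : ℝ | c ≤ e * x} := fun c e =>
    isClosed_le continuous_const (continuous_const.mul continuous_id)
  have hprob : ∀ m : ℕ, IsProbabilityMeasure (P.map (X (1 / m))) := fun m =>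
    Measure.isProbabilityMeasure_map (hX.measurable _).aemeasurable
  set S : ℕ → Finset ℕ := fun m => Finset.Ico (1 * m) (n * m)
  set T : ℕ → Finset ℕ := fun m => Finset.Ico (0 * m) (1 * m)
  have hmeas : ∀ (m : ℕ) (S : Finset ℕ) {B : Set ℝ}, MeasurableSet B →
      MeasurableSet {ω | ∃ i ∈ S, D m i ω ∈ B} := fun m S B hB => by
    have : {ω | ∃ i ∈ S, D m i ω ∈ B} = ⋃ i ∈ S, D m i ⁻¹' B := by ext; simp
    rw [this]
    exact S.measurableSet_biUnion fun i _ => hX.measurable_gridIncrement m i hB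
  refine (le_measure_setOf_frequently P
    (E := fun m => {ω | (∃ i ∈ S m, D m i ω ∈ B) ∧ ∃ j ∈ T m, D m j ω ∈ B'})
    (fun m => (hmeas m _ hB).inter (hmeas m _ hB')) ?_).trans (measure_mono ?_)
  · have hu1 : u < ν.real {x | d ≤ 1 * x} := by simpa using hu
    filter_upwards [eventually_le_mul_halfLine hν.1 hν0 hν.charFun_map_one_div abs_one hc hcd
        (sub_pos.2 hu1), eventually_le_mul_halfLine hν.1 hν0 hν.charFun_map_one_div he hc' hcd'
        (sub_pos.2 hu')] with m h1 h2
    rw [sub_sub_cancel] at h1 h2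
    rw [measure_exists_and_exists (hX.iIndepFun_gridIncrement m)
      (hX.measurable_gridIncrement m) hB hB' (Finset.Ico_disjoint_Ico_consecutive _ _ _).symm]
    refine mul_le_mul' ?_ ?_
    · refine measure_exists_mem_ge (hX.iIndepFun_gridIncrement m) (hX.measurable_gridIncrement m)
        (hX.measure_gridIncrement_preimage m) hB _ ?_
      have hn1 : (0 : ℝ) ≤ n - 1 := by
        rw [sub_nonneg]; exact_mod_cast hn
      rw [Nat.card_Ico, ← Nat.sub_mul]
      push_cast [hn]
      rw [mul_assoc]
      gcongr
    · refine measure_exists_mem_ge (hX.iIndepFun_gridIncrement m) (hX.measurable_gridIncrement m)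
        (hX.measure_gridIncrement_preimage m) hB' _ ?_
      rw [Nat.card_Ico]
      simpa using h2
  · intro ω hω
    obtain ⟨s, hs1, hsn, hs⟩ := (hX.cadlag ω).exists_pathJump_mem (hclosed c 1)
      (by simpa using hc) (p := 1) (q := n) (hω.mono fun m hm => by
        obtain ⟨⟨i, hi, hiB⟩, -⟩ := hm
        exact ⟨i, (Finset.mem_Ico.1 hi).1, (Finset.mem_Ico.1 hi).2, hiB⟩)
    obtain ⟨t, ht0, ht1, ht⟩ := (hX.cadlag ω).exists_pathJump_mem (hclosed c' e)
      (by simpa using hc') (p := 0) (q := 1) (hω.mono fun m hm => by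
        obtain ⟨-, i, hi, hiB⟩ := hm
        exact ⟨i, (Finset.mem_Ico.1 hi).1, (Finset.mem_Ico.1 hi).2, hiB⟩)
    have hn' : (1 : ℝ≥0) ≤ n := by exact_mod_cast hn
    simp only [Nat.cast_one, Nat.cast_zero] at hs1 ht0 ht1
    refine ⟨s, t, one_pos.trans hs1, hsn, ht0, ht1.trans hn', (ht1.trans_lt hs1).ne', ?_, ht⟩
    simpa using hs

end Levy

/-! ### Jump functionals on the Skorokhod space -/

namespace SkorokhodSpace

theorem jump_zero (ξ : SkorokhodSpace) : ξ.jump 0 = 0 := by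
  unfold jump
  rw [leftLim_eq_of_isBot fun t => t.2.1, sub_self]

theorem tendsto_leftLim (ξ : SkorokhodSpace) (t : I) :
    Tendsto ξ (𝓝[<] t) (𝓝 (Function.leftLim ξ t)) :=
  tendsto_leftLim_of_tendsto (ξ.isCadlag t).2

theorem nhdsLT_neBot {t : I} (ht : 0 < t) : (𝓝[<] t).NeBot :=
  nhdsLT_neBot_of_exists_lt ⟨0, ht⟩

/-- Càdlàg functions on a compact interval are bounded. -/
theorem exists_abs_le (ξ : SkorokhodSpace) : ∃ M, ∀ t, |ξ t| ≤ M := by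
  have h : ∃ M, ∀ t ∈ (univ : Set I), |ξ t| ≤ M := by
    refine isCompact_univ.induction_on (p := fun S => ∃ M, ∀ t ∈ S, |ξ t| ≤ M)
      ⟨0, fun t ht => ht.elim⟩ (fun S T hST ⟨M, hM⟩ => ⟨M, fun t ht => hM t (hST ht)⟩)
      (fun S T ⟨M, hM⟩ ⟨N, hN⟩ => ⟨max M N, ?_⟩) (fun t _ => ?_)
    · rintro t (ht | ht)
      exacts [(hM t ht).trans (le_max_left _ _), (hN t ht).trans (le_max_right _ _)]
    · have hr : ∀ᶠ u in 𝓝 t, u ∈ Ici t → |ξ u| < |ξ t| + 1 :=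
        eventually_nhdsWithin_iff.1 ((ξ.isCadlag t).1.abs.eventually_lt_const (lt_add_one _))
      have hl : ∀ᶠ u in 𝓝 t, u ∈ Iio t → |ξ u| < |Function.leftLim ξ t| + 1 :=
        eventually_nhdsWithin_iff.1 ((ξ.tendsto_leftLim t).abs.eventually_lt_const (lt_add_one _))
      refine ⟨_, nhdsWithin_le_nhds (hr.and hl),
        max (|ξ t| + 1) (|Function.leftLim ξ t| + 1), fun u hu => ?_⟩
      rcases lt_or_ge u t with h | h
      exacts [(hu.2 h).le.trans (le_max_right _ _), (hu.1 h).le.trans (le_max_left _ _)]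
  simpa using h

theorem exists_abs_jump_le (ξ : SkorokhodSpace) : ∃ M, ∀ t, |ξ.jump t| ≤ M := by
  obtain ⟨M, hM⟩ := ξ.exists_abs_le
  refine ⟨M + M, fun t => ?_⟩
  rcases (show (0 : I) ≤ t from t.2.1).eq_or_lt with rfl | ht
  · rw [jump_zero, abs_zero]
    linarith [(abs_nonneg _).trans (hM 0)]
  · have := nhdsLT_neBot ht
    exact (abs_sub _ _).trans (add_le_add (hM t)
      (le_of_tendsto (ξ.tendsto_leftLim t).abs (.of_forall hM)))

/-- Paths that are uniformly close after a change of time have close jumps at matching times. -/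
theorem abs_jump_sub_jump_le {ξ η : SkorokhodSpace} {l : I ≃o I} {ε : ℝ}
    (h : ∀ t, |ξ (l t) - η t| ≤ ε) (t : I) : |ξ.jump (l t) - η.jump t| ≤ 2 * ε := by
  have hε : 0 ≤ ε := (abs_nonneg _).trans (h 0)
  rcases (show (0 : I) ≤ t from t.2.1).eq_or_lt with rfl | ht
  · have : l 0 = 0 := l.map_bot
    rw [this, jump_zero, jump_zero, sub_zero, abs_zero]
    linarith
  · have := nhdsLT_neBot ht
    have hl : Tendsto l (𝓝[<] t) (𝓝[<] (l t)) := tendsto_nhdsWithin_iff.2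
      ⟨l.continuous.continuousWithinAt, eventually_nhdsWithin_of_forall fun s hs =>
        l.strictMono hs⟩
    have h2 : |Function.leftLim ξ (l t) - Function.leftLim η t| ≤ ε :=
      le_of_tendsto (((ξ.tendsto_leftLim (l t)).comp hl).sub (η.tendsto_leftLim t)).abs
        (.of_forall h)
    have h1 := h t
    unfold jump
    rw [abs_le] at h1 h2 ⊢
    constructor <;> linarith

theorem exists_orderIso_of_edist_lt {ξ η : SkorokhodSpace} {ε : ℝ}
    (h : edist ξ η < ENNReal.ofReal ε) :
    ∃ l : I ≃o I, ∀ t, |ξ.jump (l t) - η.jump t| ≤ 2 * ε := by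
  obtain ⟨l, hl⟩ := iInf_lt_iff.1 (show ⨅ l : I ≃o I, distortion ξ η l < ENNReal.ofReal ε from h)
  refine ⟨l, abs_jump_sub_jump_le fun t => ?_⟩
  have h1 : edist (ξ (l t)) (η t) < ENNReal.ofReal ε :=
    ((le_iSup (fun t => edist (ξ (l t)) (η t)) t).trans (le_max_right _ _)).trans_lt hl
  rw [edist_dist, ENNReal.ofReal_lt_ofReal_iff_of_nonneg dist_nonneg, Real.dist_eq] at h1
  exact h1.le

/-- A supremum of functionals is `J₁`-continuous if a time change that matches the jumps of two
paths up to `δ` also matches the functionals up to `δ`. -/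
theorem continuous_iSup_of_jump {ι : Type*} [Nonempty ι] (g : SkorokhodSpace → ι → ℝ)
    (hb : ∀ ξ, BddAbove (range (g ξ)))
    (hg : ∀ ξ η : SkorokhodSpace, ∀ (l : I ≃o I) (δ : ℝ),
      (∀ t, |ξ.jump (l t) - η.jump t| ≤ δ) → ∀ i, ∃ j, g η i ≤ g ξ j + δ) :
    Continuous fun ξ => ⨆ i, g ξ i := by
  have hle : ∀ ξ η : SkorokhodSpace, ∀ ε, edist ξ η < ENNReal.ofReal ε →
      ⨆ i, g η i ≤ (⨆ i, g ξ i) + 2 * ε := by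
    intro ξ η ε h
    obtain ⟨l, hl⟩ := exists_orderIso_of_edist_lt h
    refine ciSup_le fun i => ?_
    obtain ⟨j, hj⟩ := hg ξ η l _ hl i
    linarith [le_ciSup (hb ξ) j]
  refine continuous_iff_continuousAt.2 fun ξ => Metric.tendsto_nhds.2 fun ε hε => ?_
  filter_upwards [Metric.eball_mem_nhds ξ (ENNReal.ofReal_pos.2 (show 0 < ε / 3 by positivity))]
    with η hη
  rw [Metric.mem_eball] at hη
  have h1 := hle η ξ _ hη
  rw [edist_comm] at hη
  have h2 := hle ξ η _ hη
  rw [Real.dist_eq, abs_lt]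
  constructor <;> linarith

theorem bddAbove_mul_jump (ξ : SkorokhodSpace) {e : ℝ} (he : |e| = 1) :
    BddAbove (range fun t : Ioc (0 : I) 1 => e * ξ.jump t) := by
  obtain ⟨M, hM⟩ := ξ.exists_abs_jump_le
  refine ⟨M, forall_mem_range.2 fun t => (le_abs_self _).trans ?_⟩
  rw [abs_mul, he, one_mul]
  exact hM t

theorem continuous_iSup_mul_jump {e : ℝ} (he : |e| = 1) :
    Continuous fun ξ : SkorokhodSpace => ⨆ t : Ioc (0 : I) 1, e * ξ.jump t := by
  have : Nonempty (Ioc (0 : I) 1) := ⟨⟨1, zero_lt_one, le_rfl⟩⟩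
  refine continuous_iSup_of_jump (fun ξ (t : Ioc (0 : I) 1) => e * ξ.jump t)
    (fun ξ => ξ.bddAbove_mul_jump he) fun ξ η l δ hl t => ?_
  have h0 : l 0 = 0 := l.map_bot
  refine ⟨⟨l t, ?_, (l t).2.2⟩, ?_⟩
  · simpa [h0] using l.strictMono t.2.1
  · have h : |e * (ξ.jump (l t) - η.jump t)| ≤ δ := by rw [abs_mul, he, one_mul]; exact hl t
    have := (abs_le.1 h).1
    change e * η.jump t ≤ e * ξ.jump (l t) + δ
    linarith

theorem largestJumps_eq (ξ : SkorokhodSpace) : ξ.largestJumps =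
    (⨆ t : Ioc (0 : I) 1, 1 * ξ.jump t, ⨆ t : Ioc (0 : I) 1, (-1) * ξ.jump t) := by
  simp [largestJumps]

theorem continuous_largestJumps : Continuous largestJumps := by
  have : largestJumps = fun ξ : SkorokhodSpace => _ := funext largestJumps_eq
  rw [this]
  exact (continuous_iSup_mul_jump (by simp)).prodMk (continuous_iSup_mul_jump (by simp))

/-- Pairs of distinct times in `(0, 1]`. -/
abbrev TimePair : Type := {p : I × I // 0 < p.1 ∧ 0 < p.2 ∧ p.1 ≠ p.2}

instance : Nonempty TimePair :=
  ⟨⟨(1, ⟨1 / 2, by norm_num, by norm_num⟩), zero_lt_one, by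
    rw [← Subtype.coe_lt_coe]; norm_num, fun h => by
    have := congrArg Subtype.val h
    norm_num at this⟩⟩

/-- The second largest upward jump, counted with multiplicity. -/
def secondJump (ξ : SkorokhodSpace) : ℝ := ⨆ p : TimePair, min (ξ.jump p.1.1) (ξ.jump p.1.2)

theorem bddAbove_min_jump (ξ : SkorokhodSpace) :
    BddAbove (range fun p : TimePair => min (ξ.jump p.1.1) (ξ.jump p.1.2)) := by
  obtain ⟨M, hM⟩ := ξ.exists_abs_jump_le
  exact ⟨M, forall_mem_range.2 fun p => (min_le_left _ _).trans ((le_abs_self _).trans (hM _))⟩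

theorem continuous_secondJump : Continuous secondJump := by
  refine continuous_iSup_of_jump (fun ξ (p : TimePair) => min (ξ.jump p.1.1) (ξ.jump p.1.2))
    bddAbove_min_jump fun ξ η l δ hl p => ?_
  have h0 : l 0 = 0 := l.map_bot
  refine ⟨⟨(l p.1.1, l p.1.2), ?_, ?_, l.injective.ne p.2.2.2⟩, ?_⟩
  · simpa [h0] using l.strictMono p.2.1
  · simpa [h0] using l.strictMono p.2.2.1
  · change min _ _ ≤ min (ξ.jump (l p.1.1)) (ξ.jump (l p.1.2)) + δ
    rw [← min_add_add_right]
    refine min_le_min ?_ ?_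
    · linarith [(abs_le.1 (hl p.1.1)).1]
    · linarith [(abs_le.1 (hl p.1.2)).1]

/-- Paths with two jumps at distinct positive times: an upward one of size at least `c`, and one of
size at least `d` in the direction of the sign `e`. -/
def HasTwoJumps (e c d : ℝ) (ξ : SkorokhodSpace) : Prop :=
  ∃ s t : I, 0 < s ∧ 0 < t ∧ s ≠ t ∧ c ≤ ξ.jump s ∧ d ≤ e * ξ.jump t

/-- A closed set of pairs of jump sizes: a large first coordinate permits a tiny second one, and
hence a set of paths on which the second jump is free at a logarithmic scale. -/
def jumpRegion : Set (ℝ × ℝ) := {p | 1 ≤ p.1 ∧ Real.exp (-p.1) ≤ p.2}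

theorem isClosed_jumpRegion : IsClosed jumpRegion :=
  (isClosed_le (f := fun _ => (1 : ℝ)) continuous_const continuous_fst).inter
    (isClosed_le (f := fun p : ℝ × ℝ => Real.exp (-p.1)) (by fun_prop) continuous_snd)

/-- The two largest upward jumps. -/
def twoLargestJumps (ξ : SkorokhodSpace) : ℝ × ℝ := (ξ.largestJumps.1, ξ.secondJump)

theorem continuous_twoLargestJumps : Continuous twoLargestJumps :=
  (continuous_fst.comp continuous_largestJumps).prodMk continuous_secondJump

theorem jump_le_largestJumps_fst (ξ : SkorokhodSpace) {s : I} (hs : 0 < s) :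
    ξ.jump s ≤ ξ.largestJumps.1 := by
  rw [largestJumps_eq]
  simpa using le_ciSup (ξ.bddAbove_mul_jump (e := 1) (by simp)) ⟨s, hs, s.2.2⟩

theorem largestJumps_mem_jumpRegion {ξ : SkorokhodSpace} {L : ℝ} (hL : 1 ≤ L)
    (h : ξ.HasTwoJumps (-1) L (Real.exp (-L))) : ξ.largestJumps ∈ jumpRegion := by
  obtain ⟨s, t, hs, ht, -, hLs, hLt⟩ := h
  have h1 := hLs.trans (ξ.jump_le_largestJumps_fst hs)
  have h2 : -1 * ξ.jump t ≤ ξ.largestJumps.2 := by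
    rw [largestJumps_eq]
    exact le_ciSup (ξ.bddAbove_mul_jump (e := -1) (by simp)) ⟨t, ht, t.2.2⟩
  refine ⟨hL.trans h1, le_trans ?_ (hLt.trans h2)⟩
  gcongr

theorem twoLargestJumps_mem_jumpRegion {ξ : SkorokhodSpace} {L : ℝ} (hL : 1 ≤ L)
    (h : ξ.HasTwoJumps 1 L (Real.exp (-L))) : ξ.twoLargestJumps ∈ jumpRegion := by
  obtain ⟨s, t, hs, ht, hst, hLs, hLt⟩ := h
  rw [one_mul] at hLt
  have h1 := hLs.trans (ξ.jump_le_largestJumps_fst hs)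
  have h2 : min (ξ.jump s) (ξ.jump t) ≤ ξ.secondJump :=
    le_ciSup ξ.bddAbove_min_jump ⟨(s, t), hs, ht, hst⟩
  have h3 : Real.exp (-L) ≤ L := (Real.exp_le_one_iff.2 (by linarith)).trans hL
  refine ⟨hL.trans h1, le_trans ?_ ((le_min (h3.trans hLs) hLt).trans h2)⟩
  change Real.exp (-ξ.largestJumps.1) ≤ _
  gcongr

theorem exists_open_hasTwoJumps_of_largestJumps {ξ : SkorokhodSpace}
    (h : ξ.largestJumps ∈ jumpRegion) : ∃ y > 0, ∃ G, IsOpen G ∧ ξ ∈ G ∧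
      ∀ η ∈ G, η.HasTwoJumps (-1) y y := by
  have : Nonempty (Ioc (0 : I) 1) := ⟨⟨1, zero_lt_one, le_rfl⟩⟩
  obtain ⟨h1, h2⟩ := h
  set y := Real.exp (-ξ.largestJumps.1) / 2
  have hy : 0 < y := by positivity
  have hy1 : Real.exp (-ξ.largestJumps.1) ≤ 1 := Real.exp_le_one_iff.2 (by linarith)
  refine ⟨y, hy, {η | y < η.largestJumps.1 ∧ y < η.largestJumps.2}, ?_, ⟨?_, ?_⟩, ?_⟩
  · exact (isOpen_lt continuous_const (continuous_fst.comp continuous_largestJumps)).inter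
      (isOpen_lt continuous_const (continuous_snd.comp continuous_largestJumps))
  · have : y = Real.exp (-ξ.largestJumps.1) / 2 := rfl
    linarith
  · have : y = Real.exp (-ξ.largestJumps.1) / 2 := rfl
    linarith
  · rintro η ⟨hη1, hη2⟩
    rw [largestJumps_eq] at hη1 hη2
    obtain ⟨s, hs⟩ := exists_lt_of_lt_ciSup hη1
    obtain ⟨t, ht⟩ := exists_lt_of_lt_ciSup hη2
    refine ⟨s, t, s.2.1, t.2.1, fun hst => ?_, by linarith, ht.le⟩
    rw [hst] at hs
    linarith

theorem exists_open_hasTwoJumps_of_twoLargestJumps {ξ : SkorokhodSpace}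
    (h : ξ.twoLargestJumps ∈ jumpRegion) : ∃ y > 0, ∃ G, IsOpen G ∧ ξ ∈ G ∧
      ∀ η ∈ G, η.HasTwoJumps 1 y y := by
  have hpos : 0 < ξ.secondJump := (Real.exp_pos _).trans_le h.2
  refine ⟨ξ.secondJump / 2, by positivity, {η | ξ.secondJump / 2 < η.secondJump},
    isOpen_lt continuous_const continuous_secondJump, half_lt_self hpos, fun η hη => ?_⟩
  obtain ⟨p, hp⟩ := exists_lt_of_lt_ciSup
    (show ξ.secondJump / 2 < ⨆ p : TimePair, min (η.jump p.1.1) (η.jump p.1.2) from hη)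
  obtain ⟨h1, h2⟩ := lt_min_iff.1 hp
  exact ⟨p.1.1, p.1.2, p.2.1, p.2.2.1, p.2.2.2, h1.le, by rw [one_mul]; exact h2.le⟩

theorem HasTwoJumps.le_rate {ξ : SkorokhodSpace} {y α β : ℝ} (hy : 0 < y)
    (h : ξ.HasTwoJumps (-1) y y) :
    ENNReal.ofReal (α - 1) + ENNReal.ofReal (β - 1) ≤ rate α β ξ := by
  obtain ⟨s, t, hs, ht, -, hys, hyt⟩ := h
  unfold rate
  split_ifs
  · have h1 : (1 : ℕ∞) ≤ ξ.numUp :=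
      one_le_encard_iff_nonempty.2 ⟨s, hs, hy.trans_le hys⟩
    have h2 : (1 : ℕ∞) ≤ ξ.numDown :=
      one_le_encard_iff_nonempty.2 ⟨t, ht, by linarith⟩
    refine add_le_add (le_mul_of_one_le_right' ?_) (le_mul_of_one_le_right' ?_)
    · exact_mod_cast h1
    · exact_mod_cast h2
  · exact le_top

theorem HasTwoJumps.le_rateOneSided {ξ : SkorokhodSpace} {y α : ℝ} (hy : 0 < y)
    (h : ξ.HasTwoJumps 1 y y) :
    ENNReal.ofReal (α - 1) + ENNReal.ofReal (α - 1) ≤ rateOneSided α ξ := by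
  obtain ⟨s, t, hs, ht, hst, hys, hyt⟩ := h
  unfold rateOneSided
  split_ifs
  · have h1 : (2 : ℕ∞) ≤ ξ.numUp := by
      rw [← encard_pair hst]
      refine encard_le_encard ?_
      rintro u (rfl | rfl)
      · exact ⟨hs, hy.trans_le hys⟩
      · exact ⟨ht, by linarith⟩
    rw [← mul_two]
    gcongr
    exact_mod_cast h1
  · exact le_top

end SkorokhodSpace

section Scaled

open SkorokhodSpace

variable {Ω : Type*} [MeasurableSpace Ω] {P : Measure Ω} {X : ℝ≥0 → Ω → ℝ}

theorem jump_scaledProcess (hX : IsLevyProcess X P) (a : ℝ) (ν : Measure ℝ) {n : ℕ} (hn : 0 < n)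
    (ω : Ω) {s : I} (hs : 0 < s) :
    (scaledProcess hX a ν n ω).jump s =
      pathJump (fun t => X t ω) (n * unitInterval.toNNReal s) / n := by
  have := nhdsLT_neBot hs
  have hc : Continuous (fun s : I => (n : ℝ≥0) * unitInterval.toNNReal s) := by fun_prop
  have hl : Tendsto (fun s : I => (n : ℝ≥0) * unitInterval.toNNReal s) (𝓝[<] s)
      (𝓝[<] (n * unitInterval.toNNReal s)) :=
    tendsto_nhdsWithin_iff.2 ⟨hc.continuousWithinAt, eventually_nhdsWithin_of_forall fun u hu =>
      mul_lt_mul_of_pos_left (show unitInterval.toNNReal u < unitInterval.toNNReal s from hu)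
        (by exact_mod_cast hn)⟩
  have h1 := (tendsto_leftLim_of_tendsto (hX.cadlag ω (n * unitInterval.toNNReal s)).2).comp hl
  have hc2 : Continuous (fun s : I => (s : ℝ) * levyMean a ν) := by fun_prop
  have h2 := (h1.div_const (n : ℝ)).sub (hc2.continuousWithinAt (s := Iio s) (x := s)).tendsto
  have h3 := leftLim_eq_of_tendsto (f := (scaledProcess hX a ν n ω).toFun) h2
  unfold jump
  rw [h3]
  simp only [scaledProcess, pathJump]
  ring

theorem hasTwoJumps_scaledProcess_iff (hX : IsLevyProcess X P) (a : ℝ) (ν : Measure ℝ) {n : ℕ}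
    (hn : 0 < n) (ω : Ω) (e c d : ℝ) :
    (scaledProcess hX a ν n ω).HasTwoJumps e (c / n) (d / n) ↔
      ∃ s t : ℝ≥0, 0 < s ∧ s ≤ n ∧ 0 < t ∧ t ≤ n ∧ s ≠ t ∧
        c ≤ pathJump (fun t => X t ω) s ∧ d ≤ e * pathJump (fun t => X t ω) t := by
  have hn' : (0 : ℝ) < n := by exact_mod_cast hn
  have hn'' : (0 : ℝ≥0) < n := by exact_mod_cast hn
  have hmul : ∀ {s : I}, 0 < s → 0 < (n : ℝ≥0) * unitInterval.toNNReal s := fun {s} hs =>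
    mul_pos hn'' (show (0 : ℝ≥0) < unitInterval.toNNReal s from hs)
  have hle : ∀ s : I, (n : ℝ≥0) * unitInterval.toNNReal s ≤ n := fun s =>
    mul_le_of_le_one_right' (show unitInterval.toNNReal s ≤ 1 from s.2.2)
  constructor
  · rintro ⟨s, t, hs, ht, hst, h1, h2⟩
    rw [jump_scaledProcess hX a ν hn ω hs, div_le_div_iff_of_pos_right hn'] at h1
    rw [jump_scaledProcess hX a ν hn ω ht, ← mul_div_assoc, div_le_div_iff_of_pos_right hn'] at h2
    refine ⟨_, _, hmul hs, hle s, hmul ht, hle t, fun h => hst ?_, h1, h2⟩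
    have := mul_left_cancel₀ hn''.ne' h
    exact Subtype.ext (congrArg NNReal.toReal this)
  · rintro ⟨s, t, hs, hsn, ht, htn, hst, h1, h2⟩
    have hI : ∀ {s : ℝ≥0}, 0 < s → s ≤ n → ∃ u : I, 0 < u ∧ n * unitInterval.toNNReal u = s := by
      intro s hs hsn
      have hs' : (0 : ℝ) < s := hs
      refine ⟨⟨s / n, by positivity, ?_⟩, ?_, ?_⟩
      · rw [div_le_one hn']; exact_mod_cast hsn
      · rw [← Subtype.coe_lt_coe]
        change (0 : ℝ) < s / n
        positivity
      · apply NNReal.coe_injective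
        push_cast
        change (n : ℝ) * (s / n) = s
        field_simp
    obtain ⟨s', hs0, rfl⟩ := hI hs hsn
    obtain ⟨t', ht0, rfl⟩ := hI ht htn
    refine ⟨s', t', hs0, ht0, fun h => hst (by rw [h]), ?_, ?_⟩
    · rw [jump_scaledProcess hX a ν hn ω hs0, div_le_div_iff_of_pos_right hn']
      exact h1
    · rw [jump_scaledProcess hX a ν hn ω ht0, ← mul_div_assoc, div_le_div_iff_of_pos_right hn']
      exact h2

end Scaled

/-! ### Regular variation -/

theorem rpow_mem_Icc_of_near_one {x : ℝ} (h1 : 1 / 2 ≤ x) (h2 : x ≤ 2) (r : ℝ) :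
    x ^ r ∈ Icc ((2 : ℝ) ^ (-|r|)) (2 ^ |r|) := by
  have hx : 0 < x := by linarith
  have hl : |Real.log x| ≤ Real.log 2 := by
    rw [abs_le]
    constructor
    · rw [← Real.log_inv]; exact Real.log_le_log (by norm_num) (by linarith)
    · exact Real.log_le_log hx h2
  have hm : |Real.log x * r| ≤ Real.log 2 * |r| := by rw [abs_mul]; gcongr
  obtain ⟨h3, h4⟩ := abs_le.1 hm
  rw [Real.rpow_def_of_pos hx, Real.rpow_def_of_pos two_pos, Real.rpow_def_of_pos two_pos]
  exact ⟨Real.exp_le_exp.2 (by linarith), Real.exp_le_exp.2 h4⟩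

section RegularVariation

variable {f : ℝ → ℝ} {ρ ε : ℝ}

/-- Iterating `f (2 x) ≈ 2 ^ ρ f x` along powers of `2` and filling the gaps by monotonicity. -/
theorem IsRegularlyVarying.eventually_le_rpow (h : IsRegularlyVarying f ρ)
    (hf : AntitoneOn f (Ioi 0)) (hε : 0 < ε) : ∀ᶠ x in atTop, f x ≤ x ^ (ρ + ε) := by
  set r := ρ + ε / 2 with hr
  have hlt : (2 : ℝ) ^ ρ < 2 ^ r := Real.rpow_lt_rpow_of_exponent_lt (by norm_num) (by linarith)
  obtain ⟨x₀, hx₀⟩ := eventually_atTop.1 (h.1.and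
    (((h.2 2 two_pos).eventually_le_const hlt).and (eventually_ge_atTop 1)))
  have h0 : 0 < x₀ := by linarith [(hx₀ x₀ le_rfl).2.2]
  have hpow : ∀ k : ℕ, f (2 ^ k * x₀) ≤ ((2 : ℝ) ^ k) ^ r * f x₀ := by
    intro k
    induction k with
    | zero => simp
    | succ k ih =>
      obtain ⟨hp, hd, -⟩ :=
        hx₀ (2 ^ k * x₀) (le_mul_of_one_le_left h0.le (one_le_pow₀ (by norm_num)))
      rw [div_le_iff₀ hp] at hd
      calc f (2 ^ (k + 1) * x₀) = f (2 * (2 ^ k * x₀)) := by ring_nf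
        _ ≤ 2 ^ r * f (2 ^ k * x₀) := hd
        _ ≤ 2 ^ r * (((2 : ℝ) ^ k) ^ r * f x₀) := by gcongr
        _ = _ := by rw [pow_succ', Real.mul_rpow (by norm_num) (by positivity)]; ring
  filter_upwards [eventually_ge_atTop x₀, (tendsto_rpow_atTop (half_pos hε)).eventually_ge_atTop
    (2 ^ |r| * (x₀ ^ r)⁻¹ * f x₀)] with x hx hK
  have hxpos : 0 < x := h0.trans_le hx
  obtain ⟨k, hk1, hk2⟩ := exists_nat_pow_near ((one_le_div h0).2 hx) (one_lt_two (α := ℝ))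
  rw [le_div_iff₀ h0] at hk1
  rw [div_lt_iff₀ h0, pow_succ] at hk2
  have hθ := (rpow_mem_Icc_of_near_one (x := 2 ^ k * x₀ / x)
    (by rw [le_div_iff₀ hxpos]; linarith) (by rw [div_le_iff₀ hxpos]; linarith) r).2
  have hfx₀ := (hx₀ x₀ le_rfl).1
  rw [Real.div_rpow (by positivity) hxpos.le, Real.mul_rpow (by positivity) h0.le,
    div_le_iff₀ (by positivity)] at hθ
  have hx₀r : 0 < x₀ ^ r := by positivity
  calc f x ≤ f (2 ^ k * x₀) := hf (mem_Ioi.2 (by positivity)) hxpos hk1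
    _ ≤ ((2 : ℝ) ^ k) ^ r * f x₀ := hpow k
    _ = (((2 : ℝ) ^ k) ^ r * x₀ ^ r) * (x₀ ^ r)⁻¹ * f x₀ := by field_simp
    _ ≤ (2 ^ |r| * x ^ r) * (x₀ ^ r)⁻¹ * f x₀ := by gcongr
    _ = (2 ^ |r| * (x₀ ^ r)⁻¹ * f x₀) * x ^ r := by ring
    _ ≤ x ^ (ε / 2) * x ^ r := by gcongr
    _ = x ^ (ρ + ε) := by rw [← Real.rpow_add hxpos]; congr 1; rw [hr]; ring

theorem IsRegularlyVarying.eventually_rpow_le (h : IsRegularlyVarying f ρ)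
    (hf : AntitoneOn f (Ioi 0)) (hε : 0 < ε) : ∀ᶠ x in atTop, x ^ (ρ - ε) ≤ f x := by
  set r := ρ - ε / 2 with hr
  have hlt : (2 : ℝ) ^ r < 2 ^ ρ := Real.rpow_lt_rpow_of_exponent_lt (by norm_num) (by linarith)
  obtain ⟨x₀, hx₀⟩ := eventually_atTop.1 (h.1.and
    (((h.2 2 two_pos).eventually_const_le hlt).and (eventually_ge_atTop 1)))
  have h0 : 0 < x₀ := by linarith [(hx₀ x₀ le_rfl).2.2]
  have hpow : ∀ k : ℕ, ((2 : ℝ) ^ k) ^ r * f x₀ ≤ f (2 ^ k * x₀) := by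
    intro k
    induction k with
    | zero => simp
    | succ k ih =>
      obtain ⟨hp, hd, -⟩ :=
        hx₀ (2 ^ k * x₀) (le_mul_of_one_le_left h0.le (one_le_pow₀ (by norm_num)))
      rw [le_div_iff₀ hp] at hd
      calc ((2 : ℝ) ^ (k + 1)) ^ r * f x₀ = 2 ^ r * (((2 : ℝ) ^ k) ^ r * f x₀) := by
            rw [pow_succ', Real.mul_rpow (by norm_num) (by positivity)]; ring
        _ ≤ 2 ^ r * f (2 ^ k * x₀) := by gcongr
        _ ≤ f (2 * (2 ^ k * x₀)) := hd
        _ = _ := by ring_nf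
  have hfx₀ := (hx₀ x₀ le_rfl).1
  have hx₀r : 0 < x₀ ^ r := by positivity
  filter_upwards [eventually_ge_atTop x₀, (tendsto_rpow_atTop (half_pos hε)).eventually_ge_atTop
    (2 ^ (-|r|) * (x₀ ^ r)⁻¹ * f x₀)⁻¹] with x hx hK
  have hxpos : 0 < x := h0.trans_le hx
  obtain ⟨k, hk1, hk2⟩ := exists_nat_pow_near ((one_le_div h0).2 hx) (one_lt_two (α := ℝ))
  rw [le_div_iff₀ h0] at hk1
  rw [div_lt_iff₀ h0] at hk2
  have hk3 : (2 : ℝ) ^ (k + 1) * x₀ ≤ 2 * x := by rw [pow_succ]; linarith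
  have hθ := (rpow_mem_Icc_of_near_one (x := 2 ^ (k + 1) * x₀ / x)
    (by rw [le_div_iff₀ hxpos]; linarith) (by rw [div_le_iff₀ hxpos]; exact hk3) r).1
  rw [Real.div_rpow (by positivity) hxpos.le, Real.mul_rpow (by positivity) h0.le,
    le_div_iff₀ (by positivity)] at hθ
  have hK' : 1 ≤ (2 ^ (-|r|) * (x₀ ^ r)⁻¹ * f x₀) * x ^ (ε / 2) := by
    rwa [inv_le_iff_one_le_mul₀' (by positivity)] at hK
  calc x ^ (ρ - ε) = 1 * x ^ (ρ - ε) := (one_mul _).symm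
    _ ≤ ((2 ^ (-|r|) * (x₀ ^ r)⁻¹ * f x₀) * x ^ (ε / 2)) * x ^ (ρ - ε) := by gcongr
    _ = (2 ^ (-|r|) * x ^ r) * (x₀ ^ r)⁻¹ * f x₀ := by
        have : x ^ r = x ^ (ε / 2) * x ^ (ρ - ε) := by
          rw [← Real.rpow_add hxpos]; congr 1; rw [hr]; ring
        rw [this]; ring
    _ ≤ (((2 : ℝ) ^ (k + 1)) ^ r * x₀ ^ r) * (x₀ ^ r)⁻¹ * f x₀ := by gcongr
    _ = ((2 : ℝ) ^ (k + 1)) ^ r * f x₀ := by field_simp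
    _ ≤ f (2 ^ (k + 1) * x₀) := hpow _
    _ ≤ f x := hf hxpos (mem_Ioi.2 (by positivity)) hk2.le

theorem eventually_le_natCast_rpow (K : ℝ) (hε : 0 < ε) : ∀ᶠ n : ℕ in atTop, K ≤ (n : ℝ) ^ ε :=
  ((tendsto_rpow_atTop hε).comp tendsto_natCast_atTop_atTop).eventually_ge_atTop K

theorem IsRegularlyVarying.eventually_natCast_mul_lt (h : IsRegularlyVarying f ρ)
    (hf : AntitoneOn f (Ioi 0)) (hε : 0 < ε) {κ : ℝ} (hκ : 0 < κ) :
    ∀ᶠ n : ℕ in atTop, f (n * κ) < (n : ℝ) ^ (ρ + ε) := by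
  have hlim : Tendsto (fun n : ℕ => (n : ℝ) * κ) atTop atTop :=
    tendsto_natCast_atTop_atTop.atTop_mul_const hκ
  filter_upwards [hlim.eventually (h.eventually_le_rpow hf (half_pos hε)),
    eventually_le_natCast_rpow (κ ^ (ρ + ε / 2) + 1) (half_pos hε), eventually_gt_atTop 0]
    with n hn hκn hn0
  have hn0' : (0 : ℝ) < n := by exact_mod_cast hn0
  calc f (n * κ) ≤ (n * κ) ^ (ρ + ε / 2) := hn
    _ = κ ^ (ρ + ε / 2) * (n : ℝ) ^ (ρ + ε / 2) := by
        rw [Real.mul_rpow hn0'.le hκ.le]; ring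
    _ < (n : ℝ) ^ (ε / 2) * (n : ℝ) ^ (ρ + ε / 2) := by gcongr; linarith
    _ = (n : ℝ) ^ (ρ + ε) := by rw [← Real.rpow_add hn0']; congr 1; ring

end RegularVariation

/-! ### Bounds on logarithmic rates -/

section LogRate

variable {Ω S : Type*} [MeasurableSpace Ω] {P : Measure Ω} {Y : ℕ → Ω → S} {A : Set S}

theorem log_ofReal_natCast_rpow {n : ℕ} (hn : 0 < n) (q : ℝ) :
    ENNReal.log (ENNReal.ofReal ((n : ℝ) ^ q)) = ((q * Real.log n : ℝ) : EReal) := by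
  have hn' : (0 : ℝ) < n := by exact_mod_cast hn
  have : 0 < (n : ℝ) ^ q := by positivity
  rw [ENNReal.log_ofReal, if_neg this.not_ge, Real.log_rpow hn']

theorem le_limsup_logRate {q : ℝ}
    (h : ∀ᶠ n : ℕ in atTop, ENNReal.ofReal ((n : ℝ) ^ q) ≤ P {ω | Y n ω ∈ A}) :
    (q : EReal) ≤ limsup (logRate P Y A) atTop := by
  refine le_limsup_of_frequently_le' (Eventually.frequently ?_)
  filter_upwards [h, eventually_gt_atTop 1] with n hn hn1
  have hlog : 0 < Real.log n := Real.log_pos (by exact_mod_cast hn1)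
  unfold logRate
  rw [EReal.le_div_iff_mul_le (by exact_mod_cast hlog) (EReal.coe_ne_top _), ← EReal.coe_mul,
    ← log_ofReal_natCast_rpow (zero_lt_one.trans hn1)]
  exact ENNReal.log_monotone hn

theorem liminf_logRate_le {q : ℝ}
    (h : ∀ᶠ n : ℕ in atTop, P {ω | Y n ω ∈ A} ≤ ENNReal.ofReal ((n : ℝ) ^ q)) :
    liminf (logRate P Y A) atTop ≤ (q : EReal) := by
  refine liminf_le_of_frequently_le' (Eventually.frequently ?_)
  filter_upwards [h, eventually_gt_atTop 1] with n hn hn1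
  have hlog : 0 < Real.log n := Real.log_pos (by exact_mod_cast hn1)
  unfold logRate
  rw [EReal.div_le_iff_le_mul (by exact_mod_cast hlog) (EReal.coe_ne_top _), ← EReal.coe_mul,
    mul_comm, ← log_ofReal_natCast_rpow (zero_lt_one.trans hn1)]
  exact ENNReal.log_monotone hn

/-- The lower bound on neighbourhoods forces every candidate rate to be at least `q₂` on `F`,
which the upper bound on `F` then contradicts. No semicontinuity of the rate is involved. -/
theorem not_exists_fullLDP [TopologicalSpace S] {F : Set S} (hF : IsClosed F) {q₁ q₂ : ℝ}
    (hq : q₁ < q₂) (h1 : ((-q₁ : ℝ) : EReal) ≤ limsup (logRate P Y F) atTop)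
    (h2 : ∀ x ∈ F, ∃ G, IsOpen G ∧ x ∈ G ∧ liminf (logRate P Y G) atTop ≤ ((-q₂ : ℝ) : EReal)) :
    ¬ ∃ J : S → ℝ≥0∞, FullLDP P Y J := by
  rintro ⟨J, hlow, hup⟩
  have hJ : (q₂ : EReal) ≤ rateInf J F := by
    refine le_iInf₂ fun x hx => ?_
    obtain ⟨G, hG, hxG, hlim⟩ := h2 x hx
    have h3 := (hlow G hG).trans hlim
    rw [EReal.coe_neg, EReal.neg_le_neg_iff] at h3
    exact h3.trans (iInf₂_le x hxG)
  have h4 := h1.trans ((hup F hF).trans (EReal.neg_le_neg_iff.2 hJ))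
  rw [← EReal.coe_neg, EReal.coe_le_coe_iff] at h4
  linarith

theorem neg_rateInf_lt_limsup {F : Set S} {J : S → ℝ≥0∞} {q₁ q₂ : ℝ} (hq : q₁ < q₂)
    (h1 : ((-q₁ : ℝ) : EReal) ≤ limsup (logRate P Y F) atTop)
    (h2 : ∀ x ∈ F, ENNReal.ofReal q₂ ≤ J x) :
    -rateInf J F < limsup (logRate P Y F) atTop := by
  refine lt_of_lt_of_le ?_ h1
  have h3 : (q₂ : EReal) ≤ rateInf J F := le_iInf₂ fun x hx =>
    calc (q₂ : EReal) ≤ ((ENNReal.ofReal q₂ : ℝ≥0∞) : EReal) := by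
          rw [EReal.coe_ennreal_ofReal]; exact_mod_cast le_max_left _ _
      _ ≤ J x := by exact_mod_cast h2 x hx
  refine (EReal.neg_le_neg_iff.2 h3).trans_lt ?_
  rw [← EReal.coe_neg]
  exact_mod_cast neg_lt_neg hq

end LogRate

/-! ### Two jumps of the scaled process at a logarithmic scale -/

section Levy

open SkorokhodSpace

variable {Ω : Type*} [MeasurableSpace Ω] {P : Measure Ω} [IsProbabilityMeasure P]
  {X : ℝ≥0 → Ω → ℝ} {a b : ℝ} {ν : Measure ℝ}

theorem IsLevyMeasure.antitoneOn_halfLine (hν : IsLevyMeasure ν) {e : ℝ} (he : |e| = 1) :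
    AntitoneOn (fun x => ν.real {y | x ≤ e * y}) (Ioi 0) := fun _ hx _ _ hxy =>
  measureReal_mono (fun _ hz => hxy.trans hz) (hν.measure_halfLine_lt_top he hx).ne

/-- Two jumps bounded away from `0` after scaling have a probability of order
`n ^ (-(α - 1) - (β - 1))`, up to a small change of the exponent. -/
theorem eventually_measure_hasTwoJumps_le (hX : IsLevyProcess X P) (hν : HasLevyTriplet X P a b ν)
    (hν0 : ν ≠ 0) {α β e : ℝ} (he : |e| = 1)
    (h1 : IsRegularlyVarying (fun x => ν.real {y | x ≤ y}) (-α))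
    (h2 : IsRegularlyVarying (fun x => ν.real {y | x ≤ e * y}) (-β)) {y ε : ℝ} (hy : 0 < y)
    (hε : 0 < ε) :
    ∀ᶠ n : ℕ in atTop, P {ω | (scaledProcess hX a ν n ω).HasTwoJumps e y y} ≤
      ENNReal.ofReal ((n : ℝ) ^ (-(α + β - 2 - ε))) := by
  have ha1 : AntitoneOn (fun x => ν.real {y | x ≤ y}) (Ioi 0) := by
    simpa using hν.1.antitoneOn_halfLine (e := 1) (by simp)
  filter_upwards [h1.eventually_natCast_mul_lt ha1 (half_pos hε) (κ := y / 4) (by positivity),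
    h2.eventually_natCast_mul_lt (hν.1.antitoneOn_halfLine he) (half_pos hε) (κ := y / 4)
      (by positivity), eventually_gt_atTop 0] with n hn1 hn2 hn
  have hn' : (0 : ℝ) < n := by exact_mod_cast hn
  have hny : 0 < n * y := by positivity
  refine (measure_mono ?_).trans ((measure_exists_two_jumps_le hX hν hν0 he
    (c := n * (y / 2)) (c' := n * (y / 2)) (d := n * (y / 4)) (d' := n * (y / 4)) (by positivity)
    (by linarith) (by positivity) (by linarith) hn1 hn2 n).trans_eq ?_)
  · intro ω hω
    have hyn : y = n * y / n := by field_simp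
    rw [mem_ofPred_eq, hyn, hasTwoJumps_scaledProcess_iff hX a ν hn] at hω
    obtain ⟨s, t, hs, hsn, ht, htn, hst, hjs, hjt⟩ := hω
    exact ⟨s, t, hs, hsn, ht, htn, hst, by linarith, by linarith⟩
  · congr 1
    rw [← Real.rpow_natCast, ← Real.rpow_add hn', ← Real.rpow_add hn']
    congr 1
    push_cast
    ring

theorem tendsto_mul_exp_neg_rpow {γ : ℝ} (hγ : 0 < γ) :
    Tendsto (fun x : ℝ => x * Real.exp (-(x ^ γ / 2))) atTop (𝓝 0) := by
  have h := (tendsto_rpow_mul_exp_neg_mul_atTop_nhds_zero (1 / γ) (1 / 2) (by norm_num)).comp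
    (tendsto_rpow_atTop hγ)
  refine h.congr' ?_
  filter_upwards [eventually_gt_atTop 0] with x hx
  simp only [Function.comp_apply]
  rw [← Real.rpow_mul hx.le, mul_one_div_cancel hγ.ne', Real.rpow_one]
  congr 2
  ring

/-- One upward jump of order `n ^ γ`, with `γ > 1` close to `1`, costs a probability of order
`n ^ (-(α - 1))`, and it makes a second jump of bounded size, which is almost free, sufficient. -/
theorem eventually_le_measure_hasTwoJumps (hX : IsLevyProcess X P) (hν : HasLevyTriplet X P a b ν)
    (hν0 : ν ≠ 0) {α e : ℝ} (hα : 1 < α) (he : |e| = 1)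
    (h1 : IsRegularlyVarying (fun x => ν.real {y | x ≤ y}) (-α))
    (h2 : ∀ᶠ x in atTop, 0 < ν.real {y | x ≤ e * y}) {ε : ℝ} (hε : 0 < ε) :
    ∀ᶠ n : ℕ in atTop, ENNReal.ofReal ((n : ℝ) ^ (-(α - 1 + ε))) ≤
      P {ω | ∃ L, 1 ≤ L ∧ (scaledProcess hX a ν n ω).HasTwoJumps e L (Real.exp (-L))} := by
  have ha1 : AntitoneOn (fun x => ν.real {y | x ≤ y}) (Ioi 0) := by
    simpa using hν.1.antitoneOn_halfLine (e := 1) (by simp)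
  obtain ⟨δ, hδν, hδ⟩ := (h2.and (eventually_gt_atTop 0)).exists
  -- this choice gives `(n ^ γ) ^ (-(α + ε / 4)) = n ^ (-(α + ε / 2))`
  set γ := (α + ε / 2) / (α + ε / 4) with hγ
  have hden : 0 < α + ε / 4 := by linarith
  have hγ1 : 1 < γ := by rw [hγ, one_lt_div hden]; linarith
  set u' := ν.real {y | δ ≤ e * y} / 2 with hu'
  have hu'0 : 0 < u' := by positivity
  set K := 1 - Real.exp (-u') with hK
  have hK0 : 0 < K := sub_pos.2 (Real.exp_lt_one_iff.2 (by linarith))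
  have hlimγ : Tendsto (fun n : ℕ => (n : ℝ) ^ γ) atTop atTop :=
    (tendsto_rpow_atTop (by linarith)).comp tendsto_natCast_atTop_atTop
  have hlimexp := ((tendsto_mul_exp_neg_rpow (sub_pos.2 hγ1)).comp
    tendsto_natCast_atTop_atTop).eventually_le_const (half_pos hδ)
  filter_upwards [hlimγ.eventually (h1.eventually_rpow_le ha1 (ε := ε / 4) (by positivity)),
    hlimexp, eventually_ge_atTop 2, eventually_le_natCast_rpow 2 (sub_pos.2 hγ1),
    eventually_le_natCast_rpow (8 / K) (half_pos hε)] with n hn1 hn2 hn hn3 hn4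
  have hn' : (2 : ℝ) ≤ n := by exact_mod_cast hn
  have hn0 : (0 : ℝ) < n := by linarith
  set w := (n : ℝ) ^ (-(α + ε / 2)) with hw
  have hw0 : 0 < w := by positivity
  rw [← Real.rpow_mul hn0.le, show γ * (-α - ε / 4) = -(α + ε / 2) by
    rw [hγ]; field_simp; ring] at hn1
  have key := le_measure_exists_two_jumps hX hν hν0 he (c := n ^ γ / 2) (c' := δ / 2)
    (d := n ^ γ) (d' := δ) (u := w / 2) (u' := u') (by positivity) (half_lt_self (by positivity))
    (by positivity) (half_lt_self hδ) ((half_lt_self hw0).trans_le hn1)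
    (half_lt_self hδν) (n := n) (by omega)
  refine le_trans ?_ (key.trans (measure_mono ?_))
  · rw [← ENNReal.ofReal_mul' hK0.le]
    refine ENNReal.ofReal_le_ofReal ?_
    set v := (n : ℝ) ^ (1 - (α + ε / 2)) / 4 with hv
    have hv0 : 0 < v := by positivity
    have hv1 : v ≤ 1 := by
      have := Real.rpow_le_one_of_one_le_of_nonpos (x := (n : ℝ)) (z := 1 - (α + ε / 2))
        (by linarith) (by linarith)
      linarith
    have hnw : (n : ℝ) * w = 4 * v := by
      rw [hv, hw, sub_eq_add_neg, Real.rpow_add hn0, Real.rpow_one]; ring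
    have hvw : v ≤ (n - 1) * (w / 2) := by nlinarith
    have hexp : v / 2 ≤ 1 - Real.exp (-v) := by
      have h3 : Real.exp (-v) * (1 + v) ≤ 1 := by
        have := Real.add_one_le_exp v
        calc Real.exp (-v) * (1 + v) ≤ Real.exp (-v) * Real.exp v := by gcongr; linarith
          _ = 1 := by rw [← Real.exp_add]; simp
      nlinarith
    have h5 : (n : ℝ) ^ (-(α - 1 + ε)) * (n : ℝ) ^ (ε / 2) = 4 * v := by
      rw [hv, ← Real.rpow_add hn0]; ring_nf
    have h6 : (n : ℝ) ^ (-(α - 1 + ε)) * (8 / K) ≤ 4 * v := by rw [← h5]; gcongr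
    calc (n : ℝ) ^ (-(α - 1 + ε)) = (n : ℝ) ^ (-(α - 1 + ε)) * (8 / K) * (K / 8) := by field_simp
      _ ≤ 4 * v * (K / 8) := by gcongr
      _ = v / 2 * K := by ring
      _ ≤ (1 - Real.exp (-v)) * K := by gcongr
      _ ≤ (1 - Real.exp (-((n - 1) * (w / 2)))) * K := by gcongr
  · intro ω hω
    have h3 : (n : ℝ) ^ γ / 2 / n = (n : ℝ) ^ (γ - 1) / 2 := by
      rw [Real.rpow_sub hn0, Real.rpow_one]; field_simp
    have h4 := (hasTwoJumps_scaledProcess_iff hX a ν (by omega : 0 < n) ω e _ _).2 hω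
    rw [h3] at h4
    obtain ⟨s, t, hs, ht, hst, hjs, hjt⟩ := h4
    refine ⟨(n : ℝ) ^ (γ - 1) / 2, by linarith, s, t, hs, ht, hst, hjs, le_trans ?_ hjt⟩
    rw [le_div_iff₀ hn0, mul_comm]
    exact hn2

/-- Both failures at once, for a closed set `F` that contains all paths with an upward jump `L ≥ 1`
and a second jump of size `exp (-L)`, but near each of whose paths two jumps are bounded away
from `0`. -/
theorem ldp_failure (hX : IsLevyProcess X P) (hν : HasLevyTriplet X P a b ν)
    {α β e : ℝ} (hα : 1 < α) (hβ : 1 < β) (he : |e| = 1)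
    (h1 : IsRegularlyVarying (fun x => ν.real (Ici x)) (-α))
    (h2 : IsRegularlyVarying (fun x => ν.real {y | x ≤ e * y}) (-β))
    {F : Set SkorokhodSpace} (hF : IsClosed F)
    (hin : ∀ ξ L, 1 ≤ L → HasTwoJumps e L (Real.exp (-L)) ξ → ξ ∈ F)
    (hout : ∀ ξ ∈ F, ∃ y > 0, ∃ G, IsOpen G ∧ ξ ∈ G ∧ ∀ η ∈ G, HasTwoJumps e y y η)
    {J : SkorokhodSpace → ℝ≥0∞} (hJ : ∀ ξ, ∀ y > 0, HasTwoJumps e y y ξ →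
      ENNReal.ofReal (α - 1) + ENNReal.ofReal (β - 1) ≤ J ξ) :
    (¬ ∃ J : SkorokhodSpace → ℝ≥0∞, FullLDP P (scaledProcess hX a ν) J) ∧
      -rateInf J F < limsup (logRate P (scaledProcess hX a ν) F) atTop := by
  have hν0 : ν ≠ 0 := by
    rintro rfl
    obtain ⟨x, hx⟩ := h1.1.exists
    simp at hx
  set ε := (β - 1) / 3 with hε
  have hε0 : 0 < ε := by rw [hε]; linarith
  have hlow : ((-(α - 1 + ε) : ℝ) : EReal) ≤ limsup (logRate P (scaledProcess hX a ν) F) atTop := by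
    refine le_limsup_logRate ?_
    filter_upwards [eventually_le_measure_hasTwoJumps hX hν hν0 hα he h1 h2.1 hε0] with n hn
    exact hn.trans (measure_mono fun ω ⟨L, hL, h⟩ => hin _ L hL h)
  refine ⟨not_exists_fullLDP hF (q₂ := α + β - 2 - ε) (by linarith) hlow fun ξ hξ => ?_,
    neg_rateInf_lt_limsup (q₂ := (α - 1) + (β - 1)) (by linarith) hlow fun ξ hξ => ?_⟩
  · obtain ⟨y, hy, G, hG, hξG, hGy⟩ := hout ξ hξ
    refine ⟨G, hG, hξG, liminf_logRate_le ?_⟩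
    filter_upwards [eventually_measure_hasTwoJumps_le hX hν hν0 he h1 h2 hy hε0] with n hn
    exact le_trans (measure_mono fun ω hω => hGy (scaledProcess hX a ν n ω) hω) hn
  · obtain ⟨y, hy, G, -, hξG, hGy⟩ := hout ξ hξ
    rw [ENNReal.ofReal_add (by linarith) (by linarith)]
    exact hJ ξ y hy (hGy ξ hξG)

end Levy

end

theorem mainTheorem9 {Ω : Type*} [MeasurableSpace Ω] (P : Measure Ω) [IsProbabilityMeasure P]
    (X : ℝ≥0 → Ω → ℝ) (hX : IsLevyProcess X P)
    (a b : ℝ) (ν : Measure ℝ) (hν : HasLevyTriplet X P a b ν)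
    (α : ℝ) (hα : 1 < α) (hreg : IsRegularlyVarying (fun x => ν.real (Ici x)) (-α)) :
    -- two-sided case
    (∀ β : ℝ, 1 < β → IsRegularlyVarying (fun x => ν.real (Iic (-x))) (-β) →
      (¬ ∃ J : SkorokhodSpace → ℝ≥0∞, FullLDP P (scaledProcess hX a ν) J) ∧
      ∃ A : Set (ℝ × ℝ), IsClosed A ∧ IsClosed (SkorokhodSpace.largestJumps ⁻¹' A) ∧
        -rateInf (SkorokhodSpace.rate α β) (SkorokhodSpace.largestJumps ⁻¹' A) <
          limsup (logRate P (scaledProcess hX a ν) (SkorokhodSpace.largestJumps ⁻¹' A)) atTop) ∧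
    -- spectrally positive case
    (ν (Iio 0) = 0 →
      (¬ ∃ J : SkorokhodSpace → ℝ≥0∞, FullLDP P (scaledProcess hX a ν) J) ∧
      ∃ F : Set SkorokhodSpace, IsClosed F ∧
        -rateInf (SkorokhodSpace.rateOneSided α) F <
          limsup (logRate P (scaledProcess hX a ν) F) atTop) := by
  open SkorokhodSpace in
  refine ⟨fun β hβ hreg' => ?_, fun _ => ?_⟩
  · have hreg'' : IsRegularlyVarying (fun x => ν.real {y | x ≤ -1 * y}) (-β) := by
      convert! hreg' using 4 with x
      ext y
      simp [le_neg]
    have hcl := isClosed_jumpRegion.preimage continuous_largestJumps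
    obtain ⟨h1, h2⟩ := ldp_failure hX hν hα hβ (e := -1) (by simp) hreg hreg'' hcl
      (fun ξ L => largestJumps_mem_jumpRegion) (fun ξ => exists_open_hasTwoJumps_of_largestJumps)
      (J := rate α β) (fun ξ y => HasTwoJumps.le_rate)
    exact ⟨h1, jumpRegion, isClosed_jumpRegion, hcl, h2⟩
  · have hreg' : IsRegularlyVarying (fun x => ν.real {y | x ≤ 1 * y}) (-α) := by
      simp_rw [one_mul]
      exact hreg
    have hcl := isClosed_jumpRegion.preimage continuous_twoLargestJumps
    obtain ⟨h1, h2⟩ := ldp_failure hX hν hα hα (e := 1) (by simp) hreg hreg' hcl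
      (fun ξ L => twoLargestJumps_mem_jumpRegion)
      (fun ξ => exists_open_hasTwoJumps_of_twoLargestJumps)
      (J := rateOneSided α) (fun ξ y => HasTwoJumps.le_rateOneSided)
    exact ⟨h1, _, hcl, h2⟩
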